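/- **Setting.** Let $n\in\{2,3\}$, let $\Omega\subset\mathbb R^n$ be a bounded domain with polygonal/polyhedral boundary, $T,\nu,\alpha>0$, $(\cdot,\cdot)$ and $\|\cdot\|$ the $L^2(\Omega)$ inner product and norm, $\|v\|_1^2=\|v\|^2+\|\nabla v\|^2$, $X=[H^1_0(\Omega)]^n$, $Q=L^2_0(\Omega)$, $V=\{v\in X:(\nabla\cdot v,q)=0\ \forall q\in Q\}$, and $$b^*(u,v,w)=\tfrac12\big[((u\cdot\nabla)v,w)-((u\cdot\nabla)w,v)\big].$$ **Exact solution.** Let $(u,p)$ satisfy, for all $t\in(0,T]$, $(u_t,v)+\nu(\nabla u,\nabla v)+b^*(u,u,v)-(p,\nabla\cdot v)=(f,v)$ for all $v\in X$, with $u(t)\in V$, $p(t)\in Q$ for $t\in[0,T]$, and $u(0)=u^0\in V$. Regularity: $u\in L^2(0,T;X)\cap L^\infty(0,T;L^2)$, $\nabla u\in L^4(0,T;L^2)$, $p\in L^2(0,T;Q)$, $f\in C([0,T];L^2)$, $u$ is differentiable into $L^2$ on $[0,T]$, and $u_t$ is absolutely continuous into $L^2$ with derivative $u_{tt}\in L^2(0,T;L^2)$.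 **Discretization.** Let $m\ge2$, take a finite conforming simplicial mesh of $\overline\Omega$ of mesh size $h$ (the largest diameter of a simplex), let $X^h\subset X$ and $Q^h\subset Q$ be the continuous piecewise polynomials of degree $\le m$ and $\le m-1$ on it, and $V^h=\{v\in X^h:(\nabla\cdot v,q)=0\ \forall q\in Q^h\}$. Let $M\ge1$, $\Delta t=T/M$, $t_k=k\Delta t$, $u^k=u(t_k)$, $f^k=f(t_k)$. Let $u_h^0,\dots,u_h^M\in V^h$ be the FE approximations of $u^0,\dots,u^M$ (no particular FE scheme is prescribed). Let $d$ be the dimension of their span, $\lambda_1\ge\dots\ge\lambda_d>0$ the positive eigenvalues of $K_{k\ell}=\frac1{M+1}(u_h^\ell,u_h^k)$, with eigenvectors $z_j$ scaled so that the POD modes $\varphi_j=\lambda_j^{-1/2}\sum_\ell (z_j)_\ell u_h^\ell$ are $L^2$-orthonormal. For $0\le R<r\le d$ put $X^r=\mathrm{span}\{\varphi_1,\dots,\varphi_r\}$, $P_rv=\sum_{j\le r}(v,\varphi_j)\varphi_j$, $L^R=\mathrm{span}\{\nabla\varphi_1,\dots,\nabla\varphi_R\}$, $P_R'=I-P_R$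 with $P_R$ the $L^2$-orthogonal projection onto $L^R$, $[S_r]_{jk}=(\varphi_k,\varphi_j)+(\nabla\varphi_k,\nabla\varphi_j)$ for $1\le j,k\le r$, and $\|S_r\|_2$ the matrix 2-norm (likewise $S_R$; $\|S_0\|_2=0$). A solution of the $P_R$-VMS-POD-ROM is a family $u_r^0,\dots,u_r^M\in X^r$ with $u_r^0=P_ru^0$ and, for $0\le k<M$ and all $\varphi\in X^r$, $$\Big(\tfrac{u_r^{k+1}-u_r^k}{\Delta t},\varphi\Big)+\nu(\nabla u_r^{k+1},\nabla\varphi)+b^*(u_r^{k+1},u_r^{k+1},\varphi)+\alpha(P_R'\nabla u_r^{k+1},P_R'\nabla\varphi)=(f^{k+1},\varphi).$$ **Assumed error bounds**, with a constant $C_0$: 1. for $0\le k\le M$, $\|u^k-u_h^k\|+h\|\nabla(u^k-u_h^k)\|\le C_0(h^{m+1}+\Delta t)$; and for $1\le k\le M$ there is $q_h\in Q^h$ with $\|p(t_k)-q_h\|\le C_0h^m$; 2. for $0\le k\le M$, $\|u^k-P_ru^k\|\le C_0\big(h^{m+1}+\Delta t+\sqrt{\sum_{j=r+1}^d\lambda_j}\big)$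 and $$\|\nabla(u^k-P_ru^k)\|\le C_0\Big(h^m+\sqrt{\|S_r\|_2}\,h^{m+1}+\sqrt{1+\|S_r\|_2}\,\Delta t+\sqrt{\textstyle\sum_{j=r+1}^d\|\varphi_j\|_1^2\lambda_j}\Big).$$ **Theorem.** There are $\Delta t^*>0$ and $C$, depending only on $n,\Omega,T,\nu,\alpha,f,u,p$ and $C_0$ (so not on $m$, the mesh, $h$, $M$, $\Delta t$, the snapshots, the POD eigenvalues and modes, $r$, $R$), such that whenever $\Delta t<\Delta t^*$ and 1., 2. hold, every solution of the $P_R$-VMS-POD-ROM satisfies $$\|u^M-u_r^M\|^2+\nu\Delta t\sum_{k=0}^{M-1}\|\nabla(u^{k+1}-u_r^{k+1})\|^2\le C\Big((1+\|S_r\|_2+\|S_R\|_2)(\Delta t^2+h^{2m+2})+h^{2m}+\sum_{j=r+1}^d(1+\|\varphi_j\|_1^2)\lambda_j+\sum_{j=R+1}^d\|\varphi_j\|_1^2\lambda_j\Big).$$ -/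

import Mathlib

open MeasureTheory Set
open scoped ContDiff Matrix

noncomputable section

namespace VMSPOD

/-! ### Lebesgue and Sobolev spaces on a domain -/

/-- Points and vectors of `ℝⁿ` with the Euclidean norm. -/
abbrev Vec (n : ℕ) : Type := EuclideanSpace ℝ (Fin n)

/-- `n × n` tensors with the Frobenius norm. -/
abbrev Ten (n : ℕ) : Type := EuclideanSpace ℝ (Fin n × Fin n)

/-- `L²(Ω)`. -/
abbrev L2S {n : ℕ} (Ω : Set (Vec n)) := Lp ℝ 2 (volume.restrict Ω)

/-- `[L²(Ω)]ⁿ`. -/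
abbrev L2V {n : ℕ} (Ω : Set (Vec n)) := Lp (Vec n) 2 (volume.restrict Ω)

/-- `[L²(Ω)]ⁿˣⁿ`. -/
abbrev L2T {n : ℕ} (Ω : Set (Vec n)) := Lp (Ten n) 2 (volume.restrict Ω)

/-- The classical gradient of a vector field: entry `(i, j)` is `∂ⱼ ψᵢ`. -/
def jac {n : ℕ} (ψ : Vec n → Vec n) (x : Vec n) : Ten n :=
  WithLp.toLp 2 fun ij => fderiv ℝ ψ x (EuclideanSpace.single ij.2 1) ij.1

/-- Test fields `ψ ∈ C_c^∞(Ω; ℝⁿ)`. -/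
def IsTestField {n : ℕ} (Ω : Set (Vec n)) (ψ : Vec n → Vec n) : Prop :=
  ContDiff ℝ ∞ ψ ∧ HasCompactSupport ψ ∧ tsupport ψ ⊆ Ω

/-- The graph `{(ψ, ∇ψ) : ψ ∈ C_c^∞(Ω; ℝⁿ)}` in `L² × L²`. -/
def testGraph {n : ℕ} (Ω : Set (Vec n)) : Submodule ℝ (WithLp 2 (L2V Ω × L2T Ω)) where
  carrier := {w | ∃ ψ : Vec n → Vec n, IsTestField Ω ψ ∧
    w.fst =ᵐ[volume.restrict Ω] ψ ∧ w.snd =ᵐ[volume.restrict Ω] jac ψ}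
  zero_mem' := by
    refine ⟨0, ⟨contDiff_const, HasCompactSupport.zero, ?_⟩, ?_, ?_⟩
    · simp [tsupport]
    · exact Lp.coeFn_zero _ _ _
    · refine (Lp.coeFn_zero _ _ _).trans (Filter.Eventually.of_forall fun x => ?_)
      ext ij
      simp [jac]
  add_mem' := by
    rintro a b ⟨ψ, ⟨h1, h2, h3⟩, h4, h5⟩ ⟨χ, ⟨k1, k2, k3⟩, k4, k5⟩
    refine ⟨ψ + χ, ⟨h1.add k1, h2.add k2, ?_⟩, ?_, ?_⟩
    · exact (tsupport_add ψ χ).trans (union_subset h3 k3)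
    · rw [WithLp.add_fst]
      exact (Lp.coeFn_add _ _).trans (h4.add k4)
    · rw [WithLp.add_snd]
      refine (Lp.coeFn_add _ _).trans ((h5.add k5).trans (Filter.Eventually.of_forall fun x => ?_))
      ext ij
      have e : fderiv ℝ (ψ + χ) x = fderiv ℝ ψ x + fderiv ℝ χ x :=
        fderiv_add (h1.differentiable (by simp) x) (k1.differentiable (by simp) x)
      simp [jac, e]
  smul_mem' := by
    rintro c a ⟨ψ, ⟨h1, h2, h3⟩, h4, h5⟩
    refine ⟨c • ψ, ⟨h1.const_smul c, h2.smul_left (f := fun _ => c), ?_⟩, ?_, ?_⟩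
    · exact (closure_mono (Function.support_const_smul_subset c ψ)).trans h3
    · rw [WithLp.smul_fst]
      exact (Lp.coeFn_smul _ _).trans (h4.const_smul c)
    · rw [WithLp.smul_snd]
      refine (Lp.coeFn_smul _ _).trans ((h5.const_smul c).trans
        (Filter.Eventually.of_forall fun x => ?_))
      ext ij
      have e : fderiv ℝ (c • ψ) x = c • fderiv ℝ ψ x :=
        fderiv_const_smul (h1.differentiable (by simp) x) c
      simp [jac, e]

/-- The space `X = [H¹₀(Ω)]ⁿ`, the closure of `C_c^∞(Ω; ℝⁿ)` in the `H¹` norm. An element is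
stored as the pair `(v, ∇v)` of the function and its weak gradient (which `v` determines). The
inherited norm is `(‖v‖² + ‖∇v‖²)^{1/2}`. -/
def H10 {n : ℕ} (Ω : Set (Vec n)) : Submodule ℝ (WithLp 2 (L2V Ω × L2T Ω)) :=
  (testGraph Ω).topologicalClosure

/-- The underlying `L²` vector field of an element of `[H¹₀(Ω)]ⁿ`. -/
def fn {n : ℕ} {Ω : Set (Vec n)} (v : H10 Ω) : L2V Ω := v.1.fst

/-- The weak gradient of an element of `[H¹₀(Ω)]ⁿ`. -/
def grad {n : ℕ} {Ω : Set (Vec n)} (v : H10 Ω) : L2T Ω := v.1.snd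

/-- `(∇·v, q)`. -/
def divPair {n : ℕ} {Ω : Set (Vec n)} (v : H10 Ω) (q : L2S Ω) : ℝ :=
  ∫ x in Ω, (∑ i, grad v x (i, i)) * q x

/-- `((u·∇)v, w)`. -/
def convect {n : ℕ} {Ω : Set (Vec n)} (u v w : H10 Ω) : ℝ :=
  ∫ x in Ω, ∑ i, ∑ j, fn u x j * grad v x (i, j) * fn w x i

/-- The skew-symmetric trilinear form `b*(u, v, w)`. -/
def bStar {n : ℕ} {Ω : Set (Vec n)} (u v w : H10 Ω) : ℝ :=
  (1 / 2) * (convect u v w - convect u w v)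

/-- `Q = L²₀(Ω)`: the functions in `L²(Ω)` of mean zero. -/
def L20 {n : ℕ} (Ω : Set (Vec n)) : Set (L2S Ω) := {q | ∫ x in Ω, q x = 0}

/-- `V`: the weakly divergence-free fields in `X`. -/
def divFree {n : ℕ} (Ω : Set (Vec n)) : Set (H10 Ω) := {v | ∀ q ∈ L20 Ω, divPair v q = 0}

/-! ### The exact solution -/

/-- `(u, p)` is a solution on `[0, T]` of the weak Navier–Stokes problem with viscosity `ν` and
force `f`, with velocity derivatives `ut`, `utt` in time.

The weak form is required at every `t ∈ (0, T]`, so at all time nodes. The time derivative `ut` is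
absolutely continuous into `L²`, hence in particular `ut ∈ L²(0, T; X*)`. -/
structure IsRegularSolution {n : ℕ} {Ω : Set (Vec n)} (ν T : ℝ) (f : ℝ → L2V Ω)
    (u : ℝ → H10 Ω) (p : ℝ → L2S Ω) (ut utt : ℝ → L2V Ω) : Prop where
  /-- The momentum equation, tested with all of `X`. -/
  momentum : ∀ t ∈ Ioc 0 T, ∀ v : H10 Ω,
    inner ℝ (ut t) (fn v) + ν * inner ℝ (grad (u t)) (grad v) + bStar (u t) (u t) v
      - divPair v (p t) = inner ℝ (f t) (fn v)
  /-- Incompressibility; at `t = 0` it says `u⁰ ∈ V`. -/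
  incompressible : ∀ t ∈ Icc 0 T, u t ∈ divFree Ω
  /-- The pressure has mean zero. -/
  pressure_mean : ∀ t ∈ Icc 0 T, p t ∈ L20 Ω
  /-- `ut` is the time derivative of `u`. -/
  deriv_u : ∀ t ∈ Icc 0 T, HasDerivWithinAt (fun s => fn (u s)) (ut t) (Icc 0 T) t
  /-- `utt ∈ L²(0, T; L²)`. -/
  memLp_utt : MemLp utt 2 (volume.restrict (Icc 0 T))
  /-- `utt` is the (weak) time derivative of `ut`. -/
  deriv_ut : ∀ t ∈ Icc 0 T, ut t = ut 0 + ∫ s in (0 : ℝ)..t, utt s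
  /-- `f ∈ C([0, T]; L²)`, so that the nodal values `f(t_k)` make sense; in particular
  `f ∈ L²(0, T; L²)`. -/
  cont_f : ContinuousOn f (Icc 0 T)
  /-- `u ∈ L²(0, T; X)`. -/
  memLp_u : MemLp u 2 (volume.restrict (Icc 0 T))
  /-- `u ∈ L^∞(0, T; L²)`. -/
  memLp_u_top : MemLp (fun t => fn (u t)) ⊤ (volume.restrict (Icc 0 T))
  /-- `∇u ∈ L⁴(0, T; L²)`. -/
  memLp_grad : MemLp (fun t => grad (u t)) 4 (volume.restrict (Icc 0 T))
  /-- `p ∈ L²(0, T; Q)`. -/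
  memLp_p : MemLp p 2 (volume.restrict (Icc 0 T))

/-! ### Finite elements -/

/-- `K` is a (finite, conforming) simplicial mesh of `Ω`. -/
structure IsMesh {n : ℕ} (Ω : Set (Vec n)) (K : Geometry.SimplicialComplex ℝ (Vec n)) : Prop where
  finite : K.faces.Finite
  space_eq : K.space = closure Ω

/-- The mesh size: the largest diameter of a simplex. -/
def meshSize {n : ℕ} (K : Geometry.SimplicialComplex ℝ (Vec n)) : ℝ :=
  sSup ((fun s : Finset (Vec n) => Metric.diam (convexHull ℝ (s : Set (Vec n)))) '' K.faces)

/-- Continuous functions on the closed domain which on every simplex of the mesh are polynomials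
of total degree at most `m`. -/
def pwPoly {n : ℕ} (Ω : Set (Vec n)) (K : Geometry.SimplicialComplex ℝ (Vec n)) (m : ℕ) :
    Submodule ℝ (Vec n → ℝ) where
  carrier := {w | ContinuousOn w (closure Ω) ∧ ∀ s ∈ K.faces,
    ∃ P : MvPolynomial (Fin n) ℝ, P.totalDegree ≤ m ∧
      ∀ x ∈ convexHull ℝ (s : Set (Vec n)), w x = MvPolynomial.eval (fun i => x i) P}
  zero_mem' := ⟨continuousOn_const, fun s _ => ⟨0, by simp, by simp⟩⟩
  add_mem' := by
    rintro a b ⟨ha, ha'⟩ ⟨hb, hb'⟩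
    refine ⟨ha.add hb, fun s hs => ?_⟩
    obtain ⟨P, hP, hP'⟩ := ha' s hs
    obtain ⟨R, hR, hR'⟩ := hb' s hs
    refine ⟨P + R, (MvPolynomial.totalDegree_add P R).trans (max_le hP hR), fun x hx => ?_⟩
    simp [hP' x hx, hR' x hx]
  smul_mem' := by
    rintro c a ⟨ha, ha'⟩
    refine ⟨ha.const_smul c, fun s hs => ?_⟩
    obtain ⟨P, hP, hP'⟩ := ha' s hs
    refine ⟨c • P, (MvPolynomial.totalDegree_smul_le c P).trans hP, fun x hx => ?_⟩
    simp [hP' x hx, MvPolynomial.smul_eval]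

/-- The velocity space `X^h ⊂ X`: continuous piecewise polynomials of degree at most `m` in each
component, vanishing on the boundary. -/
def feVelocity {n : ℕ} (Ω : Set (Vec n)) (K : Geometry.SimplicialComplex ℝ (Vec n)) (m : ℕ) :
    Set (H10 Ω) :=
  {v | ∃ w : Vec n → Vec n, (∀ i, (fun x => w x i) ∈ pwPoly Ω K m) ∧
    fn v =ᵐ[volume.restrict Ω] w}

/-- The pressure space `Q^h ⊂ Q`: continuous piecewise polynomials of degree at most `m - 1` with
mean zero. -/
def fePressure {n : ℕ} (Ω : Set (Vec n)) (K : Geometry.SimplicialComplex ℝ (Vec n)) (m : ℕ) :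
    Set (L2S Ω) :=
  {q | q ∈ L20 Ω ∧ ∃ w ∈ pwPoly Ω K (m - 1), q =ᵐ[volume.restrict Ω] w}

/-- `V^h`: the discretely divergence-free fields in `X^h`. -/
def feDivFree {n : ℕ} (Ω : Set (Vec n)) (K : Geometry.SimplicialComplex ℝ (Vec n)) (m : ℕ) :
    Set (H10 Ω) :=
  {v | v ∈ feVelocity Ω K m ∧ ∀ q ∈ fePressure Ω K m, divPair v q = 0}

/-! ### Proper orthogonal decomposition

Basis functions, eigenvalues and eigenvectors are numbered from `0`; so `φ 0, …, φ (r - 1)` are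
the first `r` modes and `∑ j ∈ Finset.Ico r d` is the sum over the modes after the `r`-th. -/

/-- The snapshot correlation matrix, for `𝓗 = L²`. -/
def corrMatrix {n : ℕ} {Ω : Set (Vec n)} {M : ℕ} (U : Fin (M + 1) → H10 Ω) :
    Matrix (Fin (M + 1)) (Fin (M + 1)) ℝ :=
  Matrix.of fun k l => (1 / ((M : ℝ) + 1)) * inner ℝ (fn (U l)) (fn (U k))

/-- `lam 0 ≥ … ≥ lam (d - 1) > 0` are the positive eigenvalues of the snapshot correlation matrix
and `φ 0, …, φ (d - 1)` the associated `L²`-orthonormal POD basis functions, where `d` is the rank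
of the snapshot ensemble. (Orthonormality of the `φ j` fixes the length of the eigenvectors
`z j`.) -/
structure IsPOD {n : ℕ} {Ω : Set (Vec n)} {M : ℕ} (U : Fin (M + 1) → H10 Ω) (d : ℕ)
    (lam : ℕ → ℝ) (z : ℕ → Fin (M + 1) → ℝ) (φ : ℕ → H10 Ω) : Prop where
  rank : d = Module.finrank ℝ (Submodule.span ℝ (Set.range U))
  eigen : ∀ j < d, corrMatrix U *ᵥ z j = lam j • z j
  pos : ∀ j < d, 0 < lam j
  anti : ∀ i j, i ≤ j → j < d → lam j ≤ lam i
  basis : ∀ j < d, φ j = (1 / √(lam j)) • ∑ l, z j l • U l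
  orthonormal : ∀ i < d, ∀ j < d, inner ℝ (fn (φ i)) (fn (φ j)) = if i = j then (1 : ℝ) else 0

/-- `X^r = span {φ 0, …, φ (r - 1)}`. -/
def podSpace {n : ℕ} {Ω : Set (Vec n)} (φ : ℕ → H10 Ω) (r : ℕ) : Submodule ℝ (H10 Ω) :=
  Submodule.span ℝ (Set.range fun j : Fin r => φ j)

/-- `P_r v = ∑_{j < r} (v, φ j) φ j`, the `L²` projection on `X^r` (for `L²`-orthonormal
modes). -/
def podProj {n : ℕ} {Ω : Set (Vec n)} (φ : ℕ → H10 Ω) (r : ℕ) (v : H10 Ω) : H10 Ω :=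
  ∑ j ∈ Finset.range r, (inner ℝ (fn v) (fn (φ j)) : ℝ) • φ j

/-- `L^R = span {∇φ 0, …, ∇φ (R - 1)}`. -/
def gradSpace {n : ℕ} {Ω : Set (Vec n)} (φ : ℕ → H10 Ω) (R : ℕ) : Submodule ℝ (L2T Ω) :=
  Submodule.span ℝ (Set.range fun j : Fin R => grad (φ j))

instance {n : ℕ} {Ω : Set (Vec n)} (φ : ℕ → H10 Ω) (R : ℕ) :
    FiniteDimensional ℝ (gradSpace φ R) :=
  FiniteDimensional.span_of_finite ℝ (Set.finite_range _)

/-- `P_R' = I - P_R`, where `P_R` is the orthogonal projection of `L²` on `L^R`. -/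
def smallScale {n : ℕ} {Ω : Set (Vec n)} (φ : ℕ → H10 Ω) (R : ℕ) (G : L2T Ω) : L2T Ω :=
  G - (gradSpace φ R).starProjection G

/-- The POD stiffness matrix `S_r`. -/
def stiffness {n : ℕ} {Ω : Set (Vec n)} (φ : ℕ → H10 Ω) (r : ℕ) : Matrix (Fin r) (Fin r) ℝ :=
  Matrix.of fun j k => inner ℝ (fn (φ k)) (fn (φ j)) + inner ℝ (grad (φ k)) (grad (φ j))

/-- `‖S_r‖₂`, the matrix `2`-norm of the POD stiffness matrix. -/
def stiffNorm {n : ℕ} {Ω : Set (Vec n)} (φ : ℕ → H10 Ω) (r : ℕ) : ℝ :=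
  ‖Matrix.toEuclideanCLM (𝕜 := ℝ) (stiffness φ r)‖

/-- `‖v‖₁²`, the squared `H¹` norm. -/
def h1Sq {n : ℕ} {Ω : Set (Vec n)} (v : H10 Ω) : ℝ := ‖fn v‖ ^ 2 + ‖grad v‖ ^ 2

/-! ### The reduced-order model -/

/-- `ur 0, …, ur M` solve the `P_R`-VMS-POD-ROM with backward Euler time stepping of step `Δt`,
started from the `L²` projection of `u0`. -/
structure IsROM {n : ℕ} {Ω : Set (Vec n)} (ν α Δt : ℝ) (M : ℕ) (f : ℝ → L2V Ω) (u0 : H10 Ω)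
    (φ : ℕ → H10 Ω) (r R : ℕ) (ur : ℕ → H10 Ω) : Prop where
  initial : ur 0 = podProj φ r u0
  mem : ∀ k ≤ M, ur k ∈ podSpace φ r
  step : ∀ k < M, ∀ ψ ∈ podSpace φ r,
    inner ℝ (Δt⁻¹ • (fn (ur (k + 1)) - fn (ur k))) (fn ψ)
      + ν * inner ℝ (grad (ur (k + 1))) (grad ψ)
      + bStar (ur (k + 1)) (ur (k + 1)) ψ
      + α * inner ℝ (smallScale φ R (grad (ur (k + 1)))) (smallScale φ R (grad ψ))
      = inner ℝ (f (((k + 1 : ℕ) : ℝ) * Δt)) (fn ψ)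

/-! ### The assumed error bounds -/

/-- The assumed finite element error bounds, with constant `C₀`: `U k` is the finite element
approximation in `V^h` of the velocity at `t_k = k Δt`, and the pressure is approximated by
elements of `Q^h`. The scheme that produces the snapshots `U k` (semi-discrete, or with any time
stepping) is not prescribed, so every finite element approximation with these bounds is covered. -/
structure FEBounds {n : ℕ} {Ω : Set (Vec n)} (C₀ h Δt : ℝ)
    (K : Geometry.SimplicialComplex ℝ (Vec n)) (m M : ℕ) (u : ℝ → H10 Ω) (p : ℝ → L2S Ω)
    (U : Fin (M + 1) → H10 Ω) : Prop where
  mem : ∀ k, U k ∈ feDivFree Ω K m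
  velocity : ∀ k : Fin (M + 1),
    ‖fn (u ((k : ℕ) * Δt) - U k)‖ + h * ‖grad (u ((k : ℕ) * Δt) - U k)‖
      ≤ C₀ * (h ^ (m + 1) + Δt)
  pressure : ∀ k : ℕ, 1 ≤ k → k ≤ M → ∃ q ∈ fePressure Ω K m, ‖p (k * Δt) - q‖ ≤ C₀ * h ^ m

/-- The assumed pointwise-in-time POD projection error bounds, with constant `C₀`. -/
structure PODBounds {n : ℕ} {Ω : Set (Vec n)} (C₀ h Δt : ℝ) (m M : ℕ) (u : ℝ → H10 Ω)
    (d r : ℕ) (lam : ℕ → ℝ) (φ : ℕ → H10 Ω) : Prop where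
  l2 : ∀ k ≤ M, ‖fn (u (k * Δt) - podProj φ r (u (k * Δt)))‖
      ≤ C₀ * (h ^ (m + 1) + Δt + √(∑ j ∈ Finset.Ico r d, lam j))
  h1 : ∀ k ≤ M, ‖grad (u (k * Δt) - podProj φ r (u (k * Δt)))‖
      ≤ C₀ * (h ^ m + √(stiffNorm φ r) * h ^ (m + 1) + √(1 + stiffNorm φ r) * Δt
          + √(∑ j ∈ Finset.Ico r d, h1Sq (φ j) * lam j))

end VMSPOD

end

/-! Let w be the L² projection P_r u at a time node, η = u - w the projection error and Φ = u_r - w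
the part of the error inside X^r. The assumed bounds control η, so Φ remains. Subtracting the two
momentum equations and testing with Φ gives an energy identity (`IsROM.error_equation`). The
difference quotient of η drops out because η is L²-orthogonal to X^r. An arbitrary q_h ∈ Q^h may be
subtracted from the pressure, because the modes are combinations of snapshots and so discretely
divergence-free. By skew-symmetry the convection terms reduce to terms linear in η and b*(Φ, w, Φ)
(`SobolevConst.bStar_sub_bStar`). The last one is bounded through the embedding H¹₀ ⊂ L⁶ by
‖Φ‖^{1/2} ‖∇Φ‖^{3/2} ‖∇w‖, which Young's inequality splits between viscosity and a Gronwall term.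

The artificial viscosity leaves the consistency error P_R'∇w. Comparing with the snapshot u_h splits
w into P_r(u - u_h), estimated by the inverse inequality with ‖S_r‖₂; P_R u_h, which P_R'
annihilates; and the modes between R and r. The last part is not small at each node, but its mean
square over the snapshots is a sum of ‖∇φ_j‖² λ_j, because the POD coefficients are uncorrelated
(`IsPOD.sum_sq_norm_grad`).

The Gronwall rate must not depend on the discretization, so ‖∇w‖ needs a uniform bound. The momentum
equation tested with u bounds ∇u. If the right-hand side E of the estimate (`errorBound`) is at most
1, then ∇η, hence ∇w, is bounded as well. If E ≥ 1, the unconditional stability of the reduced model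
bounds the error by a constant, hence by that constant times E. -/

namespace VMSPOD

/-! ### Sobolev embedding into L⁶ and interpolation of L³. -/

variable {n : ℕ} {Ω : Set (Vec n)}

/-- Row-wise Cauchy–Schwarz. It links the operator norm of the Sobolev inequality for smooth
functions to the Frobenius norm of the tensors. -/
theorem norm_fderiv_le_norm_jac (ψ : Vec n → Vec n) (x : Vec n) :
    ‖fderiv ℝ ψ x‖ ≤ ‖jac ψ x‖ := by
  refine ContinuousLinearMap.opNorm_le_bound _ (norm_nonneg _) fun y => ?_
  have key : ∀ i, (fderiv ℝ ψ x y) i = ∑ j, jac ψ x (i, j) * y j := by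
    intro i
    conv_lhs => rw [← (EuclideanSpace.basisFun (Fin n) ℝ).sum_repr y]
    simp [jac, map_sum, mul_comm]
  refine abs_le_of_sq_le_sq' ?_ (by positivity) |>.2
  rw [mul_pow, EuclideanSpace.real_norm_sq_eq, EuclideanSpace.real_norm_sq_eq,
    EuclideanSpace.real_norm_sq_eq, Fintype.sum_prod_type, Finset.sum_mul]
  refine Finset.sum_le_sum fun i _ => ?_
  rw [key]
  exact Finset.sum_mul_sq_le_sq_mul_sq _ _ _

/-- The Sobolev inequality for test fields. -/
theorem exists_eLpNorm_six_testField_le (hn : n = 2 ∨ n = 3)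
    (hb : Bornology.IsBounded Ω) :
    ∃ C : NNReal, ∀ ψ : Vec n → Vec n, IsTestField Ω ψ →
      eLpNorm ψ 6 (volume.restrict Ω) ≤ C * eLpNorm (jac ψ) 2 (volume.restrict Ω) := by
  have hfin : volume Ω < ⊤ := hb.measure_lt_top
  -- In both dimensions 1/p - 1/n = 1/6. The inequality needs p < n, so p = 2 is available only for
  -- n = 3. For n = 2 the exponent 3/2 is used, and Hölder's inequality on the bounded set Ω returns
  -- to L².
  obtain ⟨p, hp1, hp2, hpn, hpq⟩ : ∃ p : NNReal, 1 ≤ p ∧ p ≤ 2 ∧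
      p < Module.finrank ℝ (Vec n) ∧
      (p : ℝ)⁻¹ - (Module.finrank ℝ (Vec n) : ℝ)⁻¹ ≤ ((6 : NNReal) : ℝ)⁻¹ := by
    rcases hn with rfl | rfl
    · refine ⟨3 / 2, ?_, ?_, ?_, ?_⟩
      · rw [← NNReal.coe_le_coe]; norm_num
      · rw [← NNReal.coe_le_coe]; norm_num
      · rw [← NNReal.coe_lt_coe]; norm_num
      · norm_num
    · refine ⟨2, by norm_num, le_rfl, ?_, ?_⟩
      · rw [← NNReal.coe_lt_coe]; norm_num
      · norm_num
  set c := eLpNormLESNormFDerivOfLeConst (Vec n) (volume : Measure (Vec n)) Ω p 6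
  set e : ℝ := 1 / (p : ENNReal).toReal - 1 / (2 : ENNReal).toReal
  have he : 0 ≤ e := by
    have h0 : (0 : ℝ) < p := lt_of_lt_of_le one_pos (by exact_mod_cast hp1)
    have h2 : (p : ℝ) ≤ 2 := by exact_mod_cast hp2
    simp only [e, ENNReal.coe_toReal, ENNReal.toReal_ofNat, sub_nonneg]
    exact one_div_le_one_div_of_le h0 h2
  have hfin' : volume Ω ^ e ≠ ⊤ := ENNReal.rpow_ne_top_of_nonneg he hfin.ne
  refine ⟨c * (volume Ω ^ e).toNNReal, fun ψ hψ => ?_⟩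
  obtain ⟨h1, h2, h3⟩ := hψ
  have hψ1 : ContDiff ℝ 1 ψ := h1.of_le (by simp)
  have hsupp : Function.support ψ ⊆ Ω := subset_closure.trans h3
  have hgn := eLpNorm_le_eLpNorm_fderiv_of_le (volume : Measure (Vec n)) (F := Vec n) hψ1 hsupp
    hp1 hpn hpq hb
  have hjs : Function.support (fun x => ‖jac ψ x‖) ⊆ Ω := by
    refine Function.support_subset_iff'.2 fun x hx => ?_
    have : fderiv ℝ ψ x = 0 := by
      by_contra h0
      exact hx (h3 (support_fderiv_subset ℝ h0))
    rw [norm_eq_zero]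
    ext ij
    simp [jac, this]
  have hjm : Continuous (fun x => ‖jac ψ x‖) := by
    refine ((PiLp.continuous_toLp 2 _).comp (continuous_pi fun ij => ?_)).norm
    exact (EuclideanSpace.proj (𝕜 := ℝ) ij.1).continuous.comp
      ((hψ1.continuous_fderiv one_ne_zero).clm_apply continuous_const)
  have hf1 : eLpNorm (fderiv ℝ ψ) p volume ≤ eLpNorm (fun x => ‖jac ψ x‖) p volume :=
    eLpNorm_mono fun x => by simpa using norm_fderiv_le_norm_jac ψ x
  have hf2 := eLpNorm_restrict_eq_of_support_subset (μ := volume) (p := (p : ENNReal)) hjs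
  have hf3 := eLpNorm_le_eLpNorm_mul_rpow_measure_univ (μ := volume.restrict Ω)
    (p := (p : ENNReal)) (q := 2) (by exact_mod_cast hp2) hjm.aestronglyMeasurable
  rw [Measure.restrict_apply_univ, hf2, eLpNorm_norm (jac ψ) (p := 2)] at hf3
  calc eLpNorm ψ 6 (volume.restrict Ω) ≤ eLpNorm ψ 6 volume := eLpNorm_restrict_le _ _ _ _
    _ ≤ c * eLpNorm (fderiv ℝ ψ) p volume := by simpa using hgn
    _ ≤ c * (eLpNorm (jac ψ) 2 (volume.restrict Ω) * volume Ω ^ e) := by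
      gcongr
      exact hf1.trans hf3
    _ = _ := by
      rw [ENNReal.coe_mul, ENNReal.coe_toNNReal hfin']
      ring

/-- The Sobolev embedding `H¹₀ ⊂ L⁶`. -/
theorem exists_eLpNorm_six_le (hn : n = 2 ∨ n = 3)
    (hb : Bornology.IsBounded Ω) :
    ∃ C : NNReal, ∀ v : H10 Ω,
      eLpNorm (fn v) 6 (volume.restrict Ω) ≤ ENNReal.ofReal (C * ‖grad v‖) := by
  obtain ⟨C, hC⟩ := exists_eLpNorm_six_testField_le hn hb
  refine ⟨C, fun v => ?_⟩
  have hv : v.1 ∈ closure (testGraph Ω : Set (WithLp 2 (L2V Ω × L2T Ω))) := v.2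
  obtain ⟨w, hw, hlim⟩ := mem_closure_iff_seq_limit.1 hv
  have hw6 : ∀ k, eLpNorm (w k).fst 6 (volume.restrict Ω) ≤ ENNReal.ofReal (C * ‖(w k).snd‖) := by
    intro k
    obtain ⟨ψ, h1, h2, h3⟩ := hw k
    rw [eLpNorm_congr_ae h2, ENNReal.ofReal_mul C.coe_nonneg, ENNReal.ofReal_coe_nnreal, Lp.norm_def,
      ENNReal.ofReal_toReal (Lp.eLpNorm_ne_top _), eLpNorm_congr_ae h3]
    exact hC ψ h1
  have h1 : Filter.Tendsto (fun k => (w k).fst) Filter.atTop (nhds (fn v)) :=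
    ((WithLp.prodContinuousLinearEquiv 2 ℝ (L2V Ω) (L2T Ω)).continuous.fst.tendsto _).comp hlim
  have h2 : Filter.Tendsto (fun k => (w k).snd) Filter.atTop (nhds (grad v)) :=
    ((WithLp.prodContinuousLinearEquiv 2 ℝ (L2V Ω) (L2T Ω)).continuous.snd.tendsto _).comp hlim
  -- Only L² convergence of the test fields is known. Along an almost everywhere convergent
  -- subsequence, Fatou's lemma carries the L⁶ bound to the limit.
  obtain ⟨s, hs, hae⟩ := (tendstoInMeasure_of_tendsto_Lp h1).exists_seq_tendsto_ae
  refine (Lp.eLpNorm_lim_le_liminf_eLpNorm (p := 6)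
    (fun k => (Lp.aestronglyMeasurable (w (s k)).fst)) _ hae).trans ?_
  refine (Filter.liminf_le_liminf (Filter.Eventually.of_forall fun k => hw6 (s k))).trans ?_
  refine (Filter.Tendsto.liminf_eq ?_).le
  exact (ENNReal.continuous_ofReal.tendsto _).comp
    ((h2.comp hs.tendsto_atTop).norm.const_mul _)

/-- Interpolation of `L³` between `L²` and `L⁶`. -/
theorem eLpNorm_three_le_mul {α E : Type*} [MeasurableSpace α] {μ : Measure α}
    [NormedAddCommGroup E] {f : α → E} (hf : AEStronglyMeasurable f μ) :
    eLpNorm f 3 μ ≤ eLpNorm f 2 μ ^ (1 / 2 : ℝ) * eLpNorm f 6 μ ^ (1 / 2 : ℝ) := by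
  have hm : AEStronglyMeasurable (fun x => ‖f x‖ ^ (1 / 2 : ℝ)) μ :=
    (hf.norm.aemeasurable.pow_const _).aestronglyMeasurable
  -- Hölder's inequality for |f| = |f|^{1/2} |f|^{1/2} with 1/4 + 1/12 = 1/3; the L⁴ and L¹² norms
  -- of |f|^{1/2} are square roots of the L² and L⁶ norms of f.
  have : ENNReal.HolderTriple 4 12 3 := ⟨by
    rw [← ENNReal.toReal_eq_toReal_iff' (by simp) (by simp), ENNReal.toReal_add (by simp) (by simp)]
    norm_num⟩
  have h := eLpNorm_smul_le_mul_eLpNorm (p := 4) (q := 12) (r := 3) hm hm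
  have e4 : (4 : ENNReal) * ENNReal.ofReal (1 / 2) = 2 := by
    rw [← ENNReal.toReal_eq_toReal_iff' (by finiteness) (by simp), ENNReal.toReal_mul]
    norm_num
  have e12 : (12 : ENNReal) * ENNReal.ofReal (1 / 2) = 6 := by
    rw [← ENNReal.toReal_eq_toReal_iff' (by finiteness) (by simp), ENNReal.toReal_mul]
    norm_num
  rw [eLpNorm_norm_rpow _ (by norm_num), eLpNorm_norm_rpow _ (by norm_num), e4, e12] at h
  refine le_of_eq_of_le ?_ h
  rw [← eLpNorm_norm]
  congr 1
  funext x
  simp only [Pi.smul_apply', smul_eq_mul]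
  rw [← Real.rpow_add_of_nonneg (norm_nonneg _) (by norm_num) (by norm_num)]
  norm_num

/-! ### Bounds of the trilinear form. -/

theorem norm_convect_integrand_le (a b : Vec n) (G : Ten n) :
    |∑ i, ∑ j, a j * G (i, j) * b i| ≤ ‖a‖ * ‖G‖ * ‖b‖ := by
  have key : ‖(WithLp.toLp 2 fun i => ∑ j, G (i, j) * a j : Vec n)‖ ≤ ‖G‖ * ‖a‖ := by
    refine abs_le_of_sq_le_sq' ?_ (by positivity) |>.2
    rw [mul_pow, EuclideanSpace.real_norm_sq_eq, EuclideanSpace.real_norm_sq_eq,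
      EuclideanSpace.real_norm_sq_eq, Fintype.sum_prod_type, Finset.sum_mul]
    refine Finset.sum_le_sum fun i _ => ?_
    exact Finset.sum_mul_sq_le_sq_mul_sq Finset.univ (fun j => G (i, j)) fun j => a j
  -- The double sum is the inner product of the vector G a with b.
  have h := abs_real_inner_le_norm (WithLp.toLp 2 fun i => ∑ j, G (i, j) * a j : Vec n) b
  have e : inner ℝ (WithLp.toLp 2 fun i => ∑ j, G (i, j) * a j : Vec n) b
      = ∑ i, ∑ j, a j * G (i, j) * b i := by
    simp only [PiLp.inner_apply, RCLike.inner_apply, conj_trivial, Finset.mul_sum]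
    exact Finset.sum_congr rfl fun i _ => Finset.sum_congr rfl fun j _ => by ring
  rw [e] at h
  calc _ ≤ _ := h
    _ ≤ ‖G‖ * ‖a‖ * ‖b‖ := by gcongr
    _ = _ := by ring

/-- The `L³` norm of the function underlying an element of `[H¹₀(Ω)]ⁿ`. -/
noncomputable def norm3 (v : H10 Ω) : ℝ := (eLpNorm (fn v) 3 (volume.restrict Ω)).toReal

/-- `[H¹₀(Ω)]ⁿ` embeds into `L⁶` with constant `C`. -/
def SobolevConst (Ω : Set (Vec n)) (C : ℝ) : Prop :=
  0 ≤ C ∧ ∀ v : H10 Ω, eLpNorm (fn v) 6 (volume.restrict Ω) ≤ ENNReal.ofReal (C * ‖grad v‖)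

theorem SobolevConst.memLp_six {C : ℝ} (hC : SobolevConst Ω C) (v : H10 Ω) :
    MemLp (fn v) 6 (volume.restrict Ω) :=
  ⟨Lp.aestronglyMeasurable _, (hC.2 v).trans_lt ENNReal.ofReal_lt_top⟩

theorem SobolevConst.eLpNorm_three_le {C : ℝ} (hC : SobolevConst Ω C) (v : H10 Ω) :
    eLpNorm (fn v) 3 (volume.restrict Ω) ≤ ENNReal.ofReal (√‖fn v‖ * √(C * ‖grad v‖)) := by
  refine (eLpNorm_three_le_mul (Lp.aestronglyMeasurable _)).trans ?_
  have hC0 := hC.1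
  rw [ENNReal.ofReal_mul (by positivity), Real.sqrt_eq_rpow, Real.sqrt_eq_rpow,
    ← ENNReal.ofReal_rpow_of_nonneg (by positivity) (by positivity),
    ← ENNReal.ofReal_rpow_of_nonneg (by positivity) (by positivity)]
  gcongr
  · rw [Lp.norm_def, ENNReal.ofReal_toReal (Lp.eLpNorm_ne_top _)]
  · exact hC.2 v

theorem SobolevConst.memLp_three {C : ℝ} (hC : SobolevConst Ω C) (v : H10 Ω) :
    MemLp (fn v) 3 (volume.restrict Ω) :=
  ⟨Lp.aestronglyMeasurable _, (hC.eLpNorm_three_le v).trans_lt ENNReal.ofReal_lt_top⟩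

theorem SobolevConst.norm3_le {C : ℝ} (hC : SobolevConst Ω C) (v : H10 Ω) :
    norm3 v ≤ √‖fn v‖ * √(C * ‖grad v‖) :=
  ENNReal.toReal_le_of_le_ofReal (by positivity) (hC.eLpNorm_three_le v)

/-- Hölder's inequality with 1/3 + 1/2 + 1/6 = 1. The convecting field gets the exponent 3, so that
after interpolation only half a power of its gradient is spent. -/
theorem SobolevConst.integrable_norm_mul {C : ℝ} (hC : SobolevConst Ω C) (u v w : H10 Ω) :
    Integrable (fun x => ‖fn u x‖ * ‖grad v x‖ * ‖fn w x‖) (volume.restrict Ω) ∧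
    ∫ x in Ω, ‖fn u x‖ * ‖grad v x‖ * ‖fn w x‖ ≤ norm3 u * ‖grad v‖ * (C * ‖grad w‖) := by
  have : ENNReal.HolderTriple 3 6 2 := ⟨by
    rw [← ENNReal.toReal_eq_toReal_iff' (by simp) (by simp), ENNReal.toReal_add (by simp) (by simp)]
    norm_num⟩
  have hu := (hC.memLp_three u).norm
  have hw := (hC.memLp_six w).norm
  have hv := (Lp.memLp (grad v)).norm
  have huw : MemLp (fun x => ‖fn u x‖ * ‖fn w x‖) 2 (volume.restrict Ω) := hw.mul' hu
  have hi : Integrable (fun x => (‖fn u x‖ * ‖fn w x‖) * ‖grad v x‖) (volume.restrict Ω) :=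
    memLp_one_iff_integrable.1 (hv.mul' huw)
  have e : (fun x => ‖fn u x‖ * ‖grad v x‖ * ‖fn w x‖)
      = fun x => (‖fn u x‖ * ‖fn w x‖) * ‖grad v x‖ := by funext x; ring
  rw [e]
  refine ⟨hi, ?_⟩
  have h1 := eLpNorm_smul_le_mul_eLpNorm (p := 3) (q := 6) (r := 2) hw.1 hu.1
  have h2 := eLpNorm_smul_le_mul_eLpNorm (p := 2) (q := 2) (r := 1) hv.1 huw.1
  rw [eLpNorm_norm, eLpNorm_norm] at h1
  rw [eLpNorm_norm] at h2
  have h3 : eLpNorm (fun x => (‖fn u x‖ * ‖fn w x‖) * ‖grad v x‖) 1 (volume.restrict Ω)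
      ≤ eLpNorm (fn u) 3 (volume.restrict Ω) * ENNReal.ofReal (C * ‖grad w‖)
        * eLpNorm (grad v) 2 (volume.restrict Ω) := by
    refine h2.trans ?_
    gcongr
    refine h1.trans ?_
    gcongr
    exact hC.2 w
  have hC0 := hC.1
  rw [eLpNorm_one_eq_lintegral_enorm] at h3
  rw [integral_eq_lintegral_of_nonneg_ae (Filter.Eventually.of_forall fun x => by positivity) hi.1]
  have e2 : ∀ x, ENNReal.ofReal ((‖fn u x‖ * ‖fn w x‖) * ‖grad v x‖)
      = ‖(‖fn u x‖ * ‖fn w x‖) * ‖grad v x‖‖ₑ := fun x =>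
    (Real.enorm_of_nonneg (by positivity)).symm
  simp_rw [e2]
  refine (ENNReal.toReal_mono ?_ h3).trans (le_of_eq ?_)
  · exact ENNReal.mul_ne_top (ENNReal.mul_ne_top (hC.memLp_three u).eLpNorm_ne_top
      ENNReal.ofReal_ne_top) (Lp.eLpNorm_ne_top _)
  · rw [ENNReal.toReal_mul, ENNReal.toReal_mul, ENNReal.toReal_ofReal (by positivity), norm3,
      Lp.norm_def (grad v)]
    ring

theorem aestronglyMeasurable_convect (u v w : H10 Ω) :
    AEStronglyMeasurable (fun x => ∑ i, ∑ j, fn u x j * grad v x (i, j) * fn w x i)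
      (volume.restrict Ω) := by
  have hu := Lp.aestronglyMeasurable (fn u)
  have hv := Lp.aestronglyMeasurable (grad v)
  have hw := Lp.aestronglyMeasurable (fn w)
  refine Finset.aestronglyMeasurable_fun_sum _ fun i _ =>
    Finset.aestronglyMeasurable_fun_sum _ fun j _ => ?_
  exact (((EuclideanSpace.proj (𝕜 := ℝ) j).continuous.comp_aestronglyMeasurable hu).mul
    ((EuclideanSpace.proj (𝕜 := ℝ) (i, j)).continuous.comp_aestronglyMeasurable hv)).mul
    ((EuclideanSpace.proj (𝕜 := ℝ) i).continuous.comp_aestronglyMeasurable hw)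

theorem SobolevConst.integrable_convect {C : ℝ} (hC : SobolevConst Ω C) (u v w : H10 Ω) :
    Integrable (fun x => ∑ i, ∑ j, fn u x j * grad v x (i, j) * fn w x i)
      (volume.restrict Ω) :=
  (hC.integrable_norm_mul u v w).1.mono' (aestronglyMeasurable_convect u v w)
    (Filter.Eventually.of_forall fun _ => norm_convect_integrand_le _ _ _)

theorem SobolevConst.abs_convect_le {C : ℝ} (hC : SobolevConst Ω C) (u v w : H10 Ω) :
    |convect u v w| ≤ norm3 u * ‖grad v‖ * (C * ‖grad w‖) :=
  (norm_integral_le_of_norm_le (f := fun x => ∑ i, ∑ j, fn u x j * grad v x (i, j) * fn w x i)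
    (hC.integrable_norm_mul u v w).1
    (Filter.Eventually.of_forall fun _ => norm_convect_integrand_le _ _ _)).trans
    (hC.integrable_norm_mul u v w).2

/-- In both halves of b* the convecting field is measured in L³, while the undifferentiated one of
the other two fields goes to L⁶; the two halves then have the same bound. -/
theorem SobolevConst.abs_bStar_le {C : ℝ} (hC : SobolevConst Ω C) (u v w : H10 Ω) :
    |bStar u v w| ≤ C * norm3 u * ‖grad v‖ * ‖grad w‖ := by
  have h1 := abs_le.1 (hC.abs_convect_le u v w)
  have h2 := abs_le.1 (hC.abs_convect_le u w v)
  rw [bStar, abs_le]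
  constructor <;> nlinarith

/-! ### Linearity of the forms and the pressure pairing. -/

@[simp] theorem fn_add (u v : H10 Ω) : fn (u + v) = fn u + fn v := rfl
@[simp] theorem fn_sub (u v : H10 Ω) : fn (u - v) = fn u - fn v := rfl
@[simp] theorem fn_smul (c : ℝ) (v : H10 Ω) : fn (c • v) = c • fn v := rfl
@[simp] theorem grad_add (u v : H10 Ω) : grad (u + v) = grad u + grad v := rfl
@[simp] theorem grad_sub (u v : H10 Ω) : grad (u - v) = grad u - grad v := rfl
@[simp] theorem grad_smul (c : ℝ) (v : H10 Ω) : grad (c • v) = c • grad v := rfl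

/-- `fn` as a linear map. -/
def fnL : H10 Ω →ₗ[ℝ] L2V Ω := { toFun := fn, map_add' := fn_add, map_smul' := fn_smul }

/-- `grad` as a linear map. -/
def gradL : H10 Ω →ₗ[ℝ] L2T Ω := { toFun := grad, map_add' := grad_add, map_smul' := grad_smul }

theorem fn_sum {ι : Type*} (s : Finset ι) (g : ι → H10 Ω) :
    fn (∑ i ∈ s, g i) = ∑ i ∈ s, fn (g i) := map_sum fnL g s

theorem grad_sum {ι : Type*} (s : Finset ι) (g : ι → H10 Ω) :
    grad (∑ i ∈ s, g i) = ∑ i ∈ s, grad (g i) := map_sum gradL g s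

/-- Splitting the integral requires both integrands to be integrable, and this is what the Sobolev
embedding supplies. -/
theorem SobolevConst.convect_add_left {C : ℝ} (hC : SobolevConst Ω C) (u u' v w : H10 Ω) :
    convect (u + u') v w = convect u v w + convect u' v w := by
  rw [convect, convect, convect, ← integral_add (hC.integrable_convect _ _ _)
    (hC.integrable_convect _ _ _)]
  refine integral_congr_ae ?_
  rw [fn_add]
  filter_upwards [Lp.coeFn_add (fn u) (fn u')] with x hx
  rw [hx]
  simp [add_mul, Finset.sum_add_distrib]

theorem SobolevConst.convect_add_mid {C : ℝ} (hC : SobolevConst Ω C) (u v v' w : H10 Ω) :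
    convect u (v + v') w = convect u v w + convect u v' w := by
  rw [convect, convect, convect, ← integral_add (hC.integrable_convect _ _ _)
    (hC.integrable_convect _ _ _)]
  refine integral_congr_ae ?_
  rw [grad_add]
  filter_upwards [Lp.coeFn_add (grad v) (grad v')] with x hx
  rw [hx]
  simp [add_mul, mul_add, Finset.sum_add_distrib]

theorem SobolevConst.convect_add_right {C : ℝ} (hC : SobolevConst Ω C) (u v w w' : H10 Ω) :
    convect u v (w + w') = convect u v w + convect u v w' := by
  rw [convect, convect, convect, ← integral_add (hC.integrable_convect _ _ _)
    (hC.integrable_convect _ _ _)]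
  refine integral_congr_ae ?_
  rw [fn_add]
  filter_upwards [Lp.coeFn_add (fn w) (fn w')] with x hx
  rw [hx]
  simp [mul_add, Finset.sum_add_distrib]

theorem SobolevConst.bStar_add_left {C : ℝ} (hC : SobolevConst Ω C) (u u' v w : H10 Ω) :
    bStar (u + u') v w = bStar u v w + bStar u' v w := by
  simp only [bStar, hC.convect_add_left]
  ring

theorem SobolevConst.bStar_add_mid {C : ℝ} (hC : SobolevConst Ω C) (u v v' w : H10 Ω) :
    bStar u (v + v') w = bStar u v w + bStar u v' w := by
  simp only [bStar, hC.convect_add_mid, hC.convect_add_right]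
  ring

@[simp] theorem bStar_self (u v : H10 Ω) : bStar u v v = 0 := by simp [bStar]

/-- Here w + η is the exact and w + Φ the reduced solution. Since b*(·, Φ, Φ) = 0, no product of
three Φ survives, and the only term quadratic in Φ carries the projection w. -/
theorem SobolevConst.bStar_sub_bStar {C : ℝ} (hC : SobolevConst Ω C) (w η Φ : H10 Ω) :
    bStar (w + η) (w + η) Φ - bStar (w + Φ) (w + Φ) Φ
      = bStar (w + η) η Φ + bStar η w Φ - bStar Φ w Φ := by
  simp only [hC.bStar_add_left, hC.bStar_add_mid, bStar_self]
  ring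

theorem integrable_divPair (v : H10 Ω) (q : L2S Ω) :
    Integrable (fun x => (∑ i, grad v x (i, i)) * q x) (volume.restrict Ω) ∧
    |divPair v q| ≤ n * ‖grad v‖ * ‖q‖ := by
  -- A crude bound of the trace by its n entries; it is the source of the factor n.
  have hb : ∀ G : Ten n, ‖∑ i, G (i, i)‖ ≤ n * ‖G‖ := fun G => by
    refine (norm_sum_le _ _).trans ((Finset.sum_le_sum fun i _ => PiLp.norm_apply_le G (i, i)).trans
      (by simp))
  have hv := Lp.memLp (grad v)
  have hm : AEStronglyMeasurable (fun x => ∑ i, grad v x (i, i)) (volume.restrict Ω) :=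
    Finset.aestronglyMeasurable_fun_sum _ fun i _ =>
      (EuclideanSpace.proj (𝕜 := ℝ) (i, i)).continuous.comp_aestronglyMeasurable hv.1
  have hd : MemLp (fun x => ∑ i, grad v x (i, i)) 2 (volume.restrict Ω) :=
    hv.of_le_mul hm (Filter.Eventually.of_forall fun x => hb _)
  have hq := Lp.memLp q
  refine ⟨memLp_one_iff_integrable.1 (hq.mul' hd), ?_⟩
  have h2 := eLpNorm_smul_le_mul_eLpNorm (p := 2) (q := 2) (r := 1) hq.1 hd.1
  have h3 : eLpNorm (fun x => ∑ i, grad v x (i, i)) 2 (volume.restrict Ω)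
      ≤ ENNReal.ofReal n * eLpNorm (grad v) 2 (volume.restrict Ω) :=
    eLpNorm_le_mul_eLpNorm_of_ae_le_mul (Filter.Eventually.of_forall fun x => hb _) 2
  rw [eLpNorm_one_eq_lintegral_enorm] at h2
  have h4 := h2.trans (mul_le_mul_left h3 _)
  have h5 := ENNReal.toReal_mono (ENNReal.mul_ne_top (ENNReal.mul_ne_top ENNReal.ofReal_ne_top
    (Lp.eLpNorm_ne_top _)) (Lp.eLpNorm_ne_top _)) h4
  rw [ENNReal.toReal_mul, ENNReal.toReal_mul, ENNReal.toReal_ofReal (by positivity),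
    ← Lp.norm_def, ← Lp.norm_def] at h5
  refine le_trans ?_ h5
  have hmq : AEStronglyMeasurable ((fun x => ∑ i, grad v x (i, i)) • ⇑q) (volume.restrict Ω) :=
    hm.mul hq.1
  rw [← integral_norm_eq_lintegral_enorm hmq]
  exact norm_integral_le_integral_norm (fun x => (∑ i, grad v x (i, i)) * q x)

theorem abs_divPair_le (v : H10 Ω) (q : L2S Ω) : |divPair v q| ≤ n * ‖grad v‖ * ‖q‖ :=
  (integrable_divPair v q).2

/-- `v ↦ (∇·v, q)` as a linear map. -/
noncomputable def divL (q : L2S Ω) : H10 Ω →ₗ[ℝ] ℝ where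
  toFun v := divPair v q
  map_add' v v' := by
    rw [divPair, divPair, divPair, ← integral_add (integrable_divPair _ _).1
      (integrable_divPair _ _).1]
    refine integral_congr_ae ?_
    rw [grad_add]
    filter_upwards [Lp.coeFn_add (grad v) (grad v')] with x hx
    rw [hx]
    simp [add_mul, Finset.sum_add_distrib]
  map_smul' c v := by
    refine (integral_congr_ae ?_).trans
      (integral_const_mul c fun x => (∑ i, grad v x (i, i)) * q x)
    rw [grad_smul]
    filter_upwards [Lp.coeFn_smul c (grad v)] with x hx
    rw [hx]
    simp only [Pi.smul_apply, PiLp.smul_apply, smul_eq_mul, ← Finset.mul_sum, mul_assoc]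

theorem divPair_sub (v : H10 Ω) (q q' : L2S Ω) :
    divPair v (q - q') = divPair v q - divPair v q' := by
  rw [divPair, divPair, divPair, ← integral_sub (integrable_divPair _ _).1
    (integrable_divPair _ _).1]
  refine integral_congr_ae ?_
  filter_upwards [Lp.coeFn_sub q q'] with x hx
  rw [hx, Pi.sub_apply, mul_sub]

/-! ### The L² projection, the inverse inequality and the small-scale projection. -/

/-- The first `r` modes are orthonormal in `L²`. -/
def OrthoModes (φ : ℕ → H10 Ω) (r : ℕ) : Prop :=
  ∀ i < r, ∀ j < r, inner ℝ (fn (φ i)) (fn (φ j)) = if i = j then (1 : ℝ) else 0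

variable {φ : ℕ → H10 Ω} {r R : ℕ}

theorem podProj_mem (φ : ℕ → H10 Ω) (r : ℕ) (v : H10 Ω) : podProj φ r v ∈ podSpace φ r := by
  refine Submodule.sum_mem _ fun j hj => Submodule.smul_mem _ _ (Submodule.subset_span ?_)
  exact ⟨⟨j, Finset.mem_range.1 hj⟩, rfl⟩

theorem podSpace_induction {p : H10 Ω → Prop} (h : ∀ j < r, p (φ j)) (h0 : p 0)
    (hadd : ∀ v w, p v → p w → p (v + w)) (hsmul : ∀ (c : ℝ) v, p v → p (c • v))
    {ψ : H10 Ω} (hψ : ψ ∈ podSpace φ r) : p ψ := by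
  refine Submodule.span_induction (p := fun v _ => p v) ?_ h0 (fun v w _ _ => hadd v w)
    (fun c v _ => hsmul c v) hψ
  rintro _ ⟨j, rfl⟩
  exact h j j.2

/-- By linearity it suffices to test with a single mode. This orthogonality removes the time
difference of the projection error from the error equation. -/
theorem OrthoModes.inner_podProj (ho : OrthoModes φ r) (v : H10 Ω) {ψ : H10 Ω}
    (hψ : ψ ∈ podSpace φ r) : inner ℝ (fn (podProj φ r v)) (fn ψ) = inner ℝ (fn v) (fn ψ) := by
  refine podSpace_induction
    (p := fun ψ => inner ℝ (fn (podProj φ r v)) (fn ψ) = inner ℝ (fn v) (fn ψ))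
    (fun j hj => ?_) ?_ (fun a b ha hb => ?_) (fun c a ha => ?_) hψ
  · rw [podProj, fn_sum, sum_inner, Finset.sum_eq_single j]
    · rw [fn_smul, real_inner_smul_left, ho j hj j hj]
      simp
    · intro i hi hij
      rw [fn_smul, real_inner_smul_left, ho i (Finset.mem_range.1 hi) j hj, if_neg hij, mul_zero]
    · intro h
      exact absurd (Finset.mem_range.2 hj) h
  · change inner ℝ (fn (podProj φ r v)) (0 : L2V Ω) = inner ℝ (fn v) (0 : L2V Ω)
    simp
  · rw [fn_add, inner_add_right, inner_add_right, ha, hb]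
  · rw [fn_smul, real_inner_smul_right, real_inner_smul_right, ha]

theorem OrthoModes.norm_podProj_le (ho : OrthoModes φ r) (v : H10 Ω) :
    ‖fn (podProj φ r v)‖ ≤ ‖fn v‖ := by
  have h := ho.inner_podProj v (podProj_mem φ r v)
  rw [real_inner_self_eq_norm_sq] at h
  have h2 := real_inner_le_norm (fn v) (fn (podProj φ r v))
  rcases (norm_nonneg (fn (podProj φ r v))).eq_or_lt with h0 | h0
  · rw [← h0]; positivity
  · nlinarith

theorem podProj_sub (φ : ℕ → H10 Ω) (r : ℕ) (v w : H10 Ω) :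
    podProj φ r (v - w) = podProj φ r v - podProj φ r w := by
  simp only [podProj, fn_sub, inner_sub_left, sub_smul, Finset.sum_sub_distrib]

/-- The squared norm of a combination of vectors with coefficients `c`. -/
theorem norm_sum_smul_sq {E ι : Type*} [NormedAddCommGroup E] [InnerProductSpace ℝ E]
    (s : Finset ι) (c : ι → ℝ) (g : ι → E) :
    ‖∑ j ∈ s, c j • g j‖ ^ 2 = ∑ i ∈ s, ∑ j ∈ s, c i * c j * inner ℝ (g i) (g j) := by
  rw [← real_inner_self_eq_norm_sq, sum_inner]
  refine Finset.sum_congr rfl fun i _ => ?_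
  rw [inner_sum]
  refine Finset.sum_congr rfl fun j _ => ?_
  rw [real_inner_smul_left, real_inner_smul_right]
  ring

theorem stiffNorm_nonneg (φ : ℕ → H10 Ω) (r : ℕ) : 0 ≤ stiffNorm φ r := norm_nonneg _

/-- The inverse inequality in the POD space. -/
theorem OrthoModes.sq_norm_grad_le (ho : OrthoModes φ r) {ψ : H10 Ω} (hψ : ψ ∈ podSpace φ r) :
    ‖grad ψ‖ ^ 2 ≤ stiffNorm φ r * ‖fn ψ‖ ^ 2 := by
  obtain ⟨c, e⟩ : ∃ c : Fin r → ℝ, ∑ j, c j • φ j = ψ :=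
    (Submodule.mem_span_range_iff_exists_fun ℝ).1 hψ
  have e1 : ‖fn ψ‖ ^ 2 = ∑ i, ∑ j, c i * c j * inner ℝ (fn (φ i)) (fn (φ j)) := by
    rw [← e, fn_sum]
    exact norm_sum_smul_sq _ _ fun j : Fin r => fn (φ j)
  have e2 : ‖grad ψ‖ ^ 2 = ∑ i, ∑ j, c i * c j * inner ℝ (grad (φ i)) (grad (φ j)) := by
    rw [← e, grad_sum]
    exact norm_sum_smul_sq _ _ fun j : Fin r => grad (φ j)
  have e3 : ‖fn ψ‖ ^ 2 = ∑ i, c i ^ 2 := by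
    rw [e1]
    refine Finset.sum_congr rfl fun i _ => ?_
    rw [Finset.sum_eq_single i]
    · rw [ho i i.2 i i.2]; simp [sq]
    · intro j _ hj
      rw [ho i i.2 j j.2, if_neg (fun h => hj (Fin.ext h.symm)), mul_zero]
    · simp
  set v : EuclideanSpace ℝ (Fin r) := WithLp.toLp 2 c with hv
  have ev : ‖v‖ ^ 2 = ‖fn ψ‖ ^ 2 := by rw [EuclideanSpace.real_norm_sq_eq, e3]
  -- The quadratic form of S_r at the coefficient vector is the squared H¹ norm of ψ, and by
  -- orthonormality the length of that vector is the L² norm of ψ.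
  have e4 : inner ℝ v (Matrix.toEuclideanCLM (𝕜 := ℝ) (stiffness φ r) v)
      = ‖fn ψ‖ ^ 2 + ‖grad ψ‖ ^ 2 := by
    rw [e1, e2, ← Finset.sum_add_distrib]
    simp only [PiLp.inner_apply, RCLike.inner_apply, conj_trivial, Matrix.ofLp_toEuclideanCLM,
      Matrix.mulVec, dotProduct, stiffness, Matrix.of_apply, hv]
    refine Finset.sum_congr rfl fun i _ => ?_
    rw [← Finset.sum_add_distrib, Finset.sum_mul]
    refine Finset.sum_congr rfl fun j _ => ?_
    rw [real_inner_comm (fn (φ i)), real_inner_comm (grad (φ i))]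
    ring
  have h1 := real_inner_le_norm v (Matrix.toEuclideanCLM (𝕜 := ℝ) (stiffness φ r) v)
  have h2 := (Matrix.toEuclideanCLM (𝕜 := ℝ) (stiffness φ r)).le_opNorm v
  have h3 : ‖v‖ * ‖Matrix.toEuclideanCLM (𝕜 := ℝ) (stiffness φ r) v‖
      ≤ ‖v‖ * (stiffNorm φ r * ‖v‖) := mul_le_mul_of_nonneg_left h2 (norm_nonneg _)
  rw [← ev] at e4 ⊢
  nlinarith [sq_nonneg ‖v‖]

theorem smallScale_add (G H : L2T Ω) :
    smallScale φ R (G + H) = smallScale φ R G + smallScale φ R H := by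
  rw [smallScale, smallScale, smallScale, map_add]
  abel

theorem smallScale_of_mem {G : L2T Ω} (hG : G ∈ gradSpace φ R) : smallScale φ R G = 0 := by
  rw [smallScale, Submodule.starProjection_eq_self_iff.2 hG, sub_self]

theorem norm_smallScale_le (φ : ℕ → H10 Ω) (R : ℕ) (G : L2T Ω) : ‖smallScale φ R G‖ ≤ ‖G‖ := by
  have h : smallScale φ R G = (gradSpace φ R)ᗮ.starProjection G := by
    rw [smallScale, Submodule.starProjection_orthogonal']
    rfl
  rw [h]
  exact Submodule.norm_starProjection_apply_le _ _

theorem grad_podProj_mem (φ : ℕ → H10 Ω) (R : ℕ) (v : H10 Ω) :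
    grad (podProj φ R v) ∈ gradSpace φ R := by
  rw [podProj, grad_sum]
  refine Submodule.sum_mem _ fun j hj => Submodule.smul_mem _ _ (Submodule.subset_span ?_)
  exact ⟨⟨j, Finset.mem_range.1 hj⟩, rfl⟩

theorem podProj_eq_add (φ : ℕ → H10 Ω) (hR : R ≤ r) (v : H10 Ω) :
    podProj φ r v = podProj φ R v
      + ∑ j ∈ Finset.Ico R r, (inner ℝ (fn v) (fn (φ j)) : ℝ) • φ j :=
  (Finset.sum_range_add_sum_Ico _ hR).symm

/-! ### Snapshots and their POD coefficients. -/

section POD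

variable {M d : ℕ} {U : Fin (M + 1) → H10 Ω} {lam : ℕ → ℝ} {z : ℕ → Fin (M + 1) → ℝ}

theorem IsPOD.orthoModes (h : IsPOD U d lam z φ) (hr : r ≤ d) : OrthoModes φ r :=
  fun i hi j hj => h.orthonormal i (hi.trans_le hr) j (hj.trans_le hr)

/-- Modes are linear combinations of snapshots and inherit every linear constraint on them. -/
theorem IsPOD.divPair_eq_zero (h : IsPOD U d lam z φ) (hr : r ≤ d) {q : L2S Ω}
    (hq : ∀ k, divPair (U k) q = 0) {ψ : H10 Ω} (hψ : ψ ∈ podSpace φ r) : divPair ψ q = 0 := by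
  have hU : ∀ k, U k ∈ LinearMap.ker (divL q) := hq
  have hle : podSpace φ r ≤ LinearMap.ker (divL q) := by
    refine Submodule.span_le.2 ?_
    rintro _ ⟨j, rfl⟩
    change φ j ∈ LinearMap.ker (divL q)
    rw [h.basis j (j.2.trans_le hr)]
    exact Submodule.smul_mem _ _ (Submodule.sum_mem _ fun l _ => Submodule.smul_mem _ _ (hU l))
  exact hle hψ

/-- The coefficients of the snapshots in the POD basis. -/
theorem IsPOD.inner_snapshot (h : IsPOD U d lam z φ) {j : ℕ} (hj : j < d) (k : Fin (M + 1)) :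
    inner ℝ (fn (U k)) (fn (φ j)) = (M + 1) * √(lam j) * z j k := by
  have hp := h.pos j hj
  have hs : √(lam j) ≠ 0 := (Real.sqrt_pos.2 hp).ne'
  have hM : (M : ℝ) + 1 ≠ 0 := by positivity
  -- The k-th row of the eigenvalue equation evaluates (u_h^k, ∑ z_l u_h^l) as (M + 1) λ z_k;
  -- normalizing the mode divides by √λ.
  have e := congrFun (h.eigen j hj) k
  simp only [Matrix.mulVec, dotProduct, corrMatrix, Matrix.of_apply, Pi.smul_apply,
    smul_eq_mul] at e
  have e2 : ∑ l, inner ℝ (fn (U l)) (fn (U k)) * z j l = (M + 1) * (lam j * z j k) := by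
    rw [← e, Finset.mul_sum]
    refine Finset.sum_congr rfl fun l _ => ?_
    field_simp
  rw [h.basis j hj, fn_smul, fn_sum, real_inner_smul_right, inner_sum]
  have e3 : ∑ l, inner ℝ (fn (U k)) (fn (z j l • U l))
      = ∑ l, inner ℝ (fn (U l)) (fn (U k)) * z j l := by
    refine Finset.sum_congr rfl fun l _ => ?_
    rw [fn_smul, real_inner_smul_right, real_inner_comm, mul_comm]
  rw [e3, e2]
  nth_rewrite 2 [← Real.mul_self_sqrt hp.le]
  field_simp

/-- The coefficients of the snapshots are uncorrelated. -/
theorem IsPOD.sum_inner_mul_inner (h : IsPOD U d lam z φ) {i j : ℕ} (hi : i < d) (hj : j < d) :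
    ∑ k, inner ℝ (fn (U k)) (fn (φ i)) * inner ℝ (fn (U k)) (fn (φ j))
      = (M + 1) * if i = j then lam j else 0 := by
  have hp := h.pos j hj
  have hs : √(lam j) ≠ 0 := (Real.sqrt_pos.2 hp).ne'
  have e1 : ∑ l, z j l • U l = √(lam j) • φ j := by
    rw [h.basis j hj, smul_smul, mul_one_div_cancel hs]
    exact (one_smul ℝ (∑ l, z j l • U l)).symm
  -- The eigenvector sum is √λ φ_j, so orthonormality of the modes does the work of orthogonality of
  -- the eigenvectors.
  have e2 : ∑ k, z j k * inner ℝ (fn (U k)) (fn (φ i)) = √(lam j) * if i = j then 1 else 0 := by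
    have e3 : inner ℝ (fn (∑ l, z j l • U l)) (fn (φ i))
        = ∑ k, z j k * inner ℝ (fn (U k)) (fn (φ i)) := by
      rw [fn_sum, sum_inner]
      refine Finset.sum_congr rfl fun k _ => ?_
      rw [fn_smul, real_inner_smul_left]
    rw [← e3, e1, fn_smul, real_inner_smul_left, real_inner_comm, h.orthonormal i hi j hj]
  calc _ = (M + 1) * √(lam j) * ∑ k, z j k * inner ℝ (fn (U k)) (fn (φ i)) := by
        rw [Finset.mul_sum]
        refine Finset.sum_congr rfl fun k _ => ?_
        rw [h.inner_snapshot hj]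
        ring
    _ = _ := by
        rw [e2]
        split_ifs
        · rw [mul_one, mul_assoc, Real.mul_self_sqrt hp.le]
        · simp

/-- The discarded part of the snapshot gradients, averaged over the snapshots. -/
theorem IsPOD.sum_sq_norm_grad (h : IsPOD U d lam z φ) (hr : r ≤ d) :
    ∑ k, ‖grad (∑ j ∈ Finset.Ico R r, (inner ℝ (fn (U k)) (fn (φ j)) : ℝ) • φ j)‖ ^ 2
      = (M + 1) * ∑ j ∈ Finset.Ico R r, ‖grad (φ j)‖ ^ 2 * lam j := by
  have hlt : ∀ j ∈ Finset.Ico R r, j < d := fun j hj => (Finset.mem_Ico.1 hj).2.trans_le hr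
  simp only [grad_sum, grad_smul, norm_sum_smul_sq]
  -- The sum over the snapshots is taken inside. It kills the off-diagonal coefficient products,
  -- although the gradients of the modes need not be orthogonal.
  rw [Finset.sum_comm, Finset.mul_sum]
  refine Finset.sum_congr rfl fun i hi => ?_
  rw [Finset.sum_comm, Finset.sum_eq_single_of_mem i hi]
  · rw [← Finset.sum_mul, h.sum_inner_mul_inner (hlt i hi) (hlt i hi), if_pos rfl,
      real_inner_self_eq_norm_sq]
    ring
  · intro j hj hji
    rw [← Finset.sum_mul, h.sum_inner_mul_inner (hlt i hi) (hlt j hj), if_neg (Ne.symm hji)]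
    simp

end POD

/-! ### Truncation error of the backward difference. -/

/-- The Cauchy–Schwarz inequality on an interval. -/
theorem sq_intervalIntegral_le {g : ℝ → ℝ} {a b : ℝ} (hab : a < b)
    (h1 : IntervalIntegrable g volume a b) (h2 : IntervalIntegrable (fun x => g x ^ 2) volume a b) :
    (∫ x in a..b, g x) ^ 2 ≤ (b - a) * ∫ x in a..b, g x ^ 2 := by
  set I := ∫ x in a..b, g x with hI
  set J := ∫ x in a..b, g x ^ 2 with hJ
  have hba : 0 < b - a := sub_pos.2 hab
  -- Expanded, this integral is (b - a)((b - a) J - I²).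
  have h0 : 0 ≤ ∫ x in a..b, ((b - a) * g x - I) ^ 2 :=
    intervalIntegral.integral_nonneg hab.le fun _ _ => sq_nonneg _
  have e : ∀ x, ((b - a) * g x - I) ^ 2
      = (b - a) ^ 2 * g x ^ 2 - (2 * (b - a) * I) * g x + I ^ 2 := fun x => by ring
  simp_rw [e] at h0
  rw [intervalIntegral.integral_add ((h2.const_mul _).sub (h1.const_mul _))
      intervalIntegrable_const, intervalIntegral.integral_sub (h2.const_mul _) (h1.const_mul _),
    intervalIntegral.integral_const_mul, intervalIntegral.integral_const_mul,
    intervalIntegral.integral_const, ← hI, ← hJ, smul_eq_mul] at h0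
  have h3 : 0 ≤ (b - a) * ((b - a) * J - I ^ 2) := by nlinarith
  nlinarith [nonneg_of_mul_nonneg_right h3 hba]

/-- The truncation error of the backward difference quotient. -/
theorem sq_norm_backward_difference_le {E : Type*} [NormedAddCommGroup E] [NormedSpace ℝ E]
    {v v' v'' : ℝ → E} {T a b : ℝ} (ha : 0 ≤ a) (hab : a < b) (hbT : b ≤ T)
    (hv : ∀ t ∈ Icc 0 T, HasDerivWithinAt v (v' t) (Icc 0 T) t)
    (hv'' : MemLp v'' 2 (volume.restrict (Icc 0 T)))
    (hv' : ∀ t ∈ Icc 0 T, v' t = v' 0 + ∫ s in (0 : ℝ)..t, v'' s) :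
    ‖v b - v a - (b - a) • v' b‖ ^ 2 ≤ (b - a) ^ 3 * ∫ s in a..b, ‖v'' s‖ ^ 2 := by
  have hint : IntegrableOn v'' (Icc 0 T) := hv''.integrable (by norm_num)
  have hsq : IntegrableOn (fun s => ‖v'' s‖ ^ 2) (Icc 0 T) := hv''.integrable_norm_pow (by norm_num)
  have hii : ∀ c ∈ Icc 0 T, ∀ d ∈ Icc 0 T, IntervalIntegrable v'' volume c d := fun c hc d hd =>
    (hint.mono_set (ordConnected_Icc.uIcc_subset hc hd)).intervalIntegrable
  have hb' : b ∈ Icc 0 T := ⟨ha.trans hab.le, hbT⟩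
  have ha' : a ∈ Icc 0 T := ⟨ha, hab.le.trans hbT⟩
  have h0' : (0 : ℝ) ∈ Icc 0 T := ⟨le_rfl, ha.trans ha'.2⟩
  have hsub : Icc a b ⊆ Icc 0 T := Icc_subset_Icc ha hbT
  set I := ∫ s in a..b, ‖v'' s‖ with hI
  have hbound : ∀ t ∈ Icc a b, ‖v' t - v' b‖ ≤ I := by
    intro t ht
    have e : v' t - v' b = -∫ s in t..b, v'' s := by
      rw [hv' t (hsub ht), hv' b hb', ← intervalIntegral.integral_interval_sub_left
        (hii 0 h0' b hb') (hii 0 h0' t (hsub ht))]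
      abel
    rw [e, norm_neg]
    refine (intervalIntegral.norm_integral_le_integral_norm ht.2).trans ?_
    refine intervalIntegral.integral_mono_interval ht.1 ht.2 le_rfl
      (Filter.Eventually.of_forall fun s => norm_nonneg _) (hii a ha' b hb').norm
  -- The mean value inequality is applied to t ↦ v(t) - t v'(b), whose derivative v'(t) - v'(b) is
  -- an integral of v''. Thus v itself need not be written as an integral of v'.
  have hmv := (convex_Icc a b).norm_image_sub_le_of_norm_hasDerivWithin_le
    (f := fun t => v t - t • v' b) (f' := fun t => v' t - v' b) (C := I)
    (fun t ht => by
      have := ((hv t (hsub ht)).mono hsub).sub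
        ((hasDerivWithinAt_id t (Icc a b)).smul_const (v' b))
      rwa [one_smul] at this)
    hbound (left_mem_Icc.2 hab.le) (right_mem_Icc.2 hab.le)
  have e : v b - b • v' b - (v a - a • v' b) = v b - v a - (b - a) • v' b := by
    rw [sub_smul]; abel
  rw [e, Real.norm_of_nonneg (sub_pos.2 hab).le] at hmv
  have hcs := sq_intervalIntegral_le hab (hii a ha' b hb').norm
    ((hsq.mono_set (ordConnected_Icc.uIcc_subset ha' hb')).intervalIntegrable)
  have hba : 0 < b - a := sub_pos.2 hab
  calc ‖v b - v a - (b - a) • v' b‖ ^ 2 ≤ (I * (b - a)) ^ 2 := by gcongr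
    _ = (b - a) ^ 2 * I ^ 2 := by ring
    _ ≤ (b - a) ^ 2 * ((b - a) * ∫ s in a..b, ‖v'' s‖ ^ 2) := by gcongr
    _ = _ := by ring

/-- The truncation errors of the backward difference quotient, summed over the time steps. -/
theorem sum_sq_norm_backward_difference_le {E : Type*} [NormedAddCommGroup E] [NormedSpace ℝ E]
    {v v' v'' : ℝ → E} {T τ : ℝ} {M : ℕ} (hτ : 0 < τ) (hM : M * τ = T)
    (hv : ∀ t ∈ Icc 0 T, HasDerivWithinAt v (v' t) (Icc 0 T) t)
    (hv'' : MemLp v'' 2 (volume.restrict (Icc 0 T)))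
    (hv' : ∀ t ∈ Icc 0 T, v' t = v' 0 + ∫ s in (0 : ℝ)..t, v'' s) :
    τ * ∑ k ∈ Finset.range M,
        ‖v' (((k + 1 : ℕ) : ℝ) * τ) - τ⁻¹ • (v (((k + 1 : ℕ) : ℝ) * τ) - v (k * τ))‖ ^ 2
      ≤ τ ^ 2 * ∫ s in (0 : ℝ)..T, ‖v'' s‖ ^ 2 := by
  have hsq : IntegrableOn (fun s => ‖v'' s‖ ^ 2) (Icc 0 T) := hv''.integrable_norm_pow (by norm_num)
  have hle : ∀ k : ℕ, k ≤ M → (k : ℝ) * τ ∈ Icc 0 T := fun k hk =>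
    ⟨by positivity, by rw [← hM]; gcongr⟩
  have hsum : ∑ k ∈ Finset.range M, ∫ s in ((k : ℝ) * τ)..(((k + 1 : ℕ) : ℝ) * τ), ‖v'' s‖ ^ 2
      = ∫ s in (0 : ℝ)..T, ‖v'' s‖ ^ 2 := by
    have := intervalIntegral.sum_integral_adjacent_intervals (n := M) (μ := volume)
      (f := fun s => ‖v'' s‖ ^ 2) (a := fun k : ℕ => (k : ℝ) * τ) fun k hk =>
        (hsq.mono_set (ordConnected_Icc.uIcc_subset (hle k hk.le)
          (hle (k + 1) hk))).intervalIntegrable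
    simpa [hM] using this
  rw [← hsum, Finset.mul_sum, Finset.mul_sum]
  refine Finset.sum_le_sum fun k hk => ?_
  have hk' := Finset.mem_range.1 hk
  have hd : ((k + 1 : ℕ) : ℝ) * τ - k * τ = τ := by push_cast; ring
  have h := sq_norm_backward_difference_le (hle k hk'.le).1 (by linarith) (hle (k + 1) hk').2
    hv hv'' hv'
  rw [hd] at h
  have e : ∀ x y : E, ‖y - τ⁻¹ • x‖ = τ⁻¹ * ‖x - τ • y‖ := fun x y => by
    have hn : ‖τ⁻¹‖ = τ⁻¹ := Real.norm_of_nonneg (inv_pos.2 hτ).le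
    rw [← norm_neg (y - τ⁻¹ • x), neg_sub]
    nth_rewrite 2 [← hn]
    rw [← norm_smul, smul_sub, inv_smul_smul₀ hτ.ne']
  rw [e, mul_pow]
  calc τ * (τ⁻¹ ^ 2 * _) ≤ τ * (τ⁻¹ ^ 2 * (τ ^ 3 *
        ∫ s in ((k : ℝ) * τ)..(((k + 1 : ℕ) : ℝ) * τ), ‖v'' s‖ ^ 2)) := by gcongr
    _ = _ := by field_simp

/-! ### Discrete Gronwall inequality. -/

/-- A discrete Gronwall inequality for implicit schemes. -/
theorem discrete_gronwall {a g s : ℕ → ℝ} {M : ℕ} {τ ν K S T : ℝ} (hτ : 0 ≤ τ) (hν : 0 ≤ ν)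
    (hK : 0 ≤ K) (hKτ : K * τ ≤ 1 / 2) (hM : M * τ = T) (ha0 : a 0 = 0) (ha : ∀ k, 0 ≤ a k)
    (hg : ∀ k, 0 ≤ g k) (hs : ∀ k, 0 ≤ s k)
    (hstep : ∀ k < M, a (k + 1) - a k + ν * τ * g (k + 1) ≤ τ * (K * a (k + 1) + s k))
    (hS : τ * ∑ k ∈ Finset.range M, s k ≤ S) :
    a M + ν * τ * ∑ k ∈ Finset.range M, g (k + 1) ≤ (1 + K * T * Real.exp (2 * K * T)) * S := by
  set q := Real.exp (2 * K * τ) with hq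
  have hKτ0 : 0 ≤ K * τ := mul_nonneg hK hτ
  have hq0 : 0 < q := Real.exp_pos _
  -- For 0 ≤ x ≤ 1/2, e^{2x}(1 - x) ≥ (1 + 2x)(1 - x) ≥ 1. This is where the time step must be
  -- small.
  have hq1 : 1 ≤ q * (1 - K * τ) := by
    have := Real.add_one_le_exp (2 * K * τ)
    nlinarith
  have hq2 : 1 ≤ q := Real.one_le_exp (by linarith)
  have hind : ∀ k ≤ M, a k ≤ q ^ k * (τ * ∑ j ∈ Finset.range k, s j) := by
    intro k
    induction k with
    | zero => intro _; simp [ha0]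
    | succ k ih =>
      intro hk
      have h1 := ih (Nat.le_of_succ_le hk)
      have h2 := hstep k hk
      have h3 : 0 ≤ ν * τ * g (k + 1) := mul_nonneg (mul_nonneg hν hτ) (hg _)
      have h4 : a (k + 1) * (1 - K * τ) ≤ a k + τ * s k := by nlinarith
      have h5 : a (k + 1) ≤ q * (a k + τ * s k) := by
        calc a (k + 1) ≤ a (k + 1) * (q * (1 - K * τ)) := le_mul_of_one_le_right (ha _) hq1
          _ = q * (a (k + 1) * (1 - K * τ)) := by ring
          _ ≤ _ := by gcongr
      have h6 : τ * s k ≤ q ^ k * (τ * s k) :=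
        le_mul_of_one_le_left (mul_nonneg hτ (hs _)) (one_le_pow₀ hq2)
      rw [Finset.sum_range_succ, pow_succ]
      calc a (k + 1) ≤ q * (a k + τ * s k) := h5
        _ ≤ q * (q ^ k * (τ * ∑ j ∈ Finset.range k, s j) + q ^ k * (τ * s k)) := by
          gcongr
        _ = _ := by ring
  have hS0 : 0 ≤ S := (mul_nonneg hτ (Finset.sum_nonneg fun k _ => hs _)).trans hS
  have hbd : ∀ k ≤ M, a k ≤ Real.exp (2 * K * T) * S := by
    intro k hk
    refine (hind k hk).trans ?_
    have e : q ^ k ≤ Real.exp (2 * K * T) := by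
      rw [hq, ← Real.exp_nat_mul]
      refine Real.exp_le_exp.2 ?_
      have : (k : ℝ) ≤ M := by exact_mod_cast hk
      calc (k : ℝ) * (2 * K * τ) = 2 * (K * τ) * k := by ring
        _ ≤ 2 * (K * τ) * M := by gcongr
        _ = _ := by rw [← hM]; ring
    refine mul_le_mul e (le_trans ?_ hS) (mul_nonneg hτ (Finset.sum_nonneg fun k _ => hs _))
      (Real.exp_pos _).le
    refine mul_le_mul_of_nonneg_left ?_ hτ
    exact Finset.sum_le_sum_of_subset_of_nonneg (Finset.range_mono hk) fun k _ _ => hs _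
  -- The step inequality is summed a second time, now with the uniform bound on `a` inserted, in
  -- order to recover the dissipation.
  have hsum := Finset.sum_le_sum fun k (hk : k ∈ Finset.range M) =>
    hstep k (Finset.mem_range.1 hk)
  rw [Finset.sum_add_distrib, Finset.sum_range_sub, ha0, ← Finset.mul_sum, ← Finset.mul_sum,
    Finset.sum_add_distrib, ← Finset.mul_sum] at hsum
  have hsa : ∑ k ∈ Finset.range M, a (k + 1) ≤ M * (Real.exp (2 * K * T) * S) := by
    refine (Finset.sum_le_card_nsmul _ _ _ fun k hk => hbd _ (Finset.mem_range.1 hk)).trans ?_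
    simp
  have h7 : τ * (K * ∑ k ∈ Finset.range M, a (k + 1))
      ≤ τ * (K * (M * (Real.exp (2 * K * T) * S))) := by gcongr
  have h8 : τ * (K * (M * (Real.exp (2 * K * T) * S))) = K * T * Real.exp (2 * K * T) * S := by
    rw [← hM]; ring
  linarith

/-! ### A priori bounds of the exact solution. -/

section Bounds

variable {ν T : ℝ} {f : ℝ → L2V Ω} {u : ℝ → H10 Ω} {p : ℝ → L2S Ω} {ut utt : ℝ → L2V Ω}

theorem IsRegularSolution.exists_bound_f (hu : IsRegularSolution ν T f u p ut utt) :
    ∃ F, 0 ≤ F ∧ ∀ t ∈ Icc 0 T, ‖f t‖ ≤ F := by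
  obtain ⟨F, hF⟩ := isCompact_Icc.exists_bound_of_continuousOn hu.cont_f
  exact ⟨max F 0, le_max_right _ _, fun t ht => (hF t ht).trans (le_max_left _ _)⟩

theorem IsRegularSolution.exists_bound_u (hu : IsRegularSolution ν T f u p ut utt) :
    ∃ B, 0 ≤ B ∧ ∀ t ∈ Icc 0 T, ‖fn (u t)‖ ≤ B := by
  -- Differentiability in time makes u continuous into L², so the bound holds at every time and in
  -- particular at the nodes, not just almost everywhere.
  obtain ⟨F, hF⟩ := isCompact_Icc.exists_bound_of_continuousOn
    (fun t ht => (hu.deriv_u t ht).continuousWithinAt)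
  exact ⟨max F 0, le_max_right _ _, fun t ht => (hF t ht).trans (le_max_left _ _)⟩

theorem IsRegularSolution.exists_bound_ut (hu : IsRegularSolution ν T f u p ut utt)
    (hT : 0 ≤ T) : ∃ A, 0 ≤ A ∧ ∀ t ∈ Icc 0 T, ‖ut t‖ ≤ A := by
  have hint : IntegrableOn utt (Icc 0 T) := hu.memLp_utt.integrable (by norm_num)
  have hii : IntervalIntegrable utt volume 0 T :=
    (hint.mono_set (ordConnected_Icc.uIcc_subset (left_mem_Icc.2 hT)
      (right_mem_Icc.2 hT))).intervalIntegrable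
  refine ⟨‖ut 0‖ + ∫ s in (0 : ℝ)..T, ‖utt s‖, ?_, fun t ht => ?_⟩
  · exact add_nonneg (norm_nonneg _)
      (intervalIntegral.integral_nonneg hT fun _ _ => norm_nonneg _)
  · rw [hu.deriv_ut t ht]
    refine (norm_add_le _ _).trans (add_le_add_right ?_ _)
    refine (intervalIntegral.norm_integral_le_integral_norm ht.1).trans ?_
    exact intervalIntegral.integral_mono_interval le_rfl ht.1 ht.2
      (Filter.Eventually.of_forall fun s => norm_nonneg _) hii.norm

/-- Testing the momentum equation with `u(t)` bounds `∇u` uniformly in time. -/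
theorem IsRegularSolution.exists_bound_grad (hu : IsRegularSolution ν T f u p ut utt)
    (hν : 0 < ν) (hT : 0 ≤ T) : ∃ G, 0 ≤ G ∧ ∀ t ∈ Ioc 0 T, ‖grad (u t)‖ ≤ G := by
  obtain ⟨F, hF0, hF⟩ := hu.exists_bound_f
  obtain ⟨B, hB0, hB⟩ := hu.exists_bound_u
  obtain ⟨A, hA0, hA⟩ := hu.exists_bound_ut hT
  refine ⟨√(ν⁻¹ * ((F + A) * B)), Real.sqrt_nonneg _, fun t ht => Real.le_sqrt_of_sq_le ?_⟩
  have ht' : t ∈ Icc 0 T := ⟨ht.1.le, ht.2⟩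
  -- Convection vanishes by skew-symmetry and pressure by incompressibility, which leaves ν‖∇u‖² =
  -- (f - u_t, u).
  have h := hu.momentum t ht (u t)
  rw [bStar_self, hu.incompressible t ht' _ (hu.pressure_mean t ht'),
    real_inner_self_eq_norm_sq] at h
  have h1 := real_inner_le_norm (f t) (fn (u t))
  have h2 := (abs_le.1 (abs_real_inner_le_norm (ut t) (fn (u t)))).1
  have h3 : ‖f t‖ * ‖fn (u t)‖ ≤ F * B := mul_le_mul (hF t ht') (hB t ht') (norm_nonneg _) hF0
  have h4 : ‖ut t‖ * ‖fn (u t)‖ ≤ A * B := mul_le_mul (hA t ht') (hB t ht') (norm_nonneg _) hA0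
  have h5 : ν * ‖grad (u t)‖ ^ 2 ≤ (F + A) * B := by linarith
  rwa [← div_eq_inv_mul, le_div_iff₀ hν, mul_comm]

end Bounds

/-! ### Poincaré inequality and continuity of b*. -/

theorem exists_sobolevConst (hn : n = 2 ∨ n = 3) (hb : Bornology.IsBounded Ω) :
    ∃ C, SobolevConst Ω C := by
  obtain ⟨C, hC⟩ := exists_eLpNorm_six_le hn hb
  exact ⟨C, C.coe_nonneg, hC⟩

/-- The Poincaré inequality. -/
theorem SobolevConst.exists_norm_fn_le {C : ℝ} (hC : SobolevConst Ω C)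
    (hb : Bornology.IsBounded Ω) : ∃ P, 0 ≤ P ∧ ∀ v : H10 Ω, ‖fn v‖ ≤ P * ‖grad v‖ := by
  have hfin : volume Ω < ⊤ := hb.measure_lt_top
  have he : (0 : ℝ) ≤ 1 / (2 : ENNReal).toReal - 1 / (6 : ENNReal).toReal := by norm_num
  have hfin' := ENNReal.rpow_ne_top_of_nonneg he hfin.ne
  set V := volume Ω ^ (1 / (2 : ENNReal).toReal - 1 / (6 : ENNReal).toReal)
  have hC0 := hC.1
  refine ⟨C * V.toReal, by positivity, fun v => ?_⟩
  have h := eLpNorm_le_eLpNorm_mul_rpow_measure_univ (μ := volume.restrict Ω)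
    (p := 2) (q := 6) (by norm_num) (Lp.aestronglyMeasurable (fn v))
  rw [Measure.restrict_apply_univ] at h
  have h2 := h.trans (mul_le_mul_left (hC.2 v) V)
  rw [Lp.norm_def]
  refine (ENNReal.toReal_mono (ENNReal.mul_ne_top ENNReal.ofReal_ne_top hfin') h2).trans ?_
  rw [ENNReal.toReal_mul, ENNReal.toReal_ofReal (by positivity)]
  exact le_of_eq (by ring)

/-- The two continuity bounds of the form `b*`. -/
theorem exists_bStar_bound (hn : n = 2 ∨ n = 3) (hb : Bornology.IsBounded Ω) :
    ∃ A, 0 ≤ A ∧ ∀ v w y : H10 Ω,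
      |bStar v w y| ≤ A * ‖grad v‖ * ‖grad w‖ * ‖grad y‖ ∧
      |bStar v w y| ≤ A * (√‖fn v‖ * √‖grad v‖) * ‖grad w‖ * ‖grad y‖ := by
  obtain ⟨C, hC⟩ := exists_sobolevConst hn hb
  obtain ⟨P, hP0, hP⟩ := hC.exists_norm_fn_le hb
  have hC0 := hC.1
  have h2 : ∀ v w y : H10 Ω,
      |bStar v w y| ≤ C * √C * (√‖fn v‖ * √‖grad v‖) * ‖grad w‖ * ‖grad y‖ := by
    intro v w y
    refine (hC.abs_bStar_le v w y).trans ?_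
    have := hC.norm3_le v
    rw [Real.sqrt_mul hC0] at this
    calc C * norm3 v * ‖grad w‖ * ‖grad y‖
        ≤ C * (√‖fn v‖ * (√C * √‖grad v‖)) * ‖grad w‖ * ‖grad y‖ := by gcongr
      _ = _ := by ring
  -- The half-power bound has constant C√C; Poincaré turns it into the full gradient bound at the
  -- cost of √P. The factor 1 + √P serves both.
  refine ⟨C * √C * (1 + √P), by positivity, fun v w y => ⟨?_, ?_⟩⟩
  · refine (h2 v w y).trans ?_
    have h3 : √‖fn v‖ * √‖grad v‖ ≤ √P * ‖grad v‖ := by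
      calc √‖fn v‖ * √‖grad v‖ ≤ √(P * ‖grad v‖) * √‖grad v‖ := by gcongr; exact hP v
        _ = √P * ‖grad v‖ := by
          rw [Real.sqrt_mul hP0, mul_assoc, Real.mul_self_sqrt (norm_nonneg _)]
    have h4 : √P * ‖grad v‖ ≤ (1 + √P) * ‖grad v‖ := by
      gcongr; linarith
    calc C * √C * (√‖fn v‖ * √‖grad v‖) * ‖grad w‖ * ‖grad y‖
        ≤ C * √C * ((1 + √P) * ‖grad v‖) * ‖grad w‖ * ‖grad y‖ := by
          have := h3.trans h4
          refine mul_le_mul_of_nonneg_right (mul_le_mul_of_nonneg_right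
            (mul_le_mul_of_nonneg_left this (by positivity)) (norm_nonneg _)) (norm_nonneg _)
      _ = _ := by ring
  · refine (h2 v w y).trans ?_
    refine mul_le_mul_of_nonneg_right (mul_le_mul_of_nonneg_right
      (mul_le_mul_of_nonneg_right ?_ (by positivity)) (norm_nonneg _)) (norm_nonneg _)
    exact le_mul_of_one_le_right (by positivity) (by linarith [Real.sqrt_nonneg P])

/-! ### Stability and energy inequality of the reduced model. -/

section ROM

variable {ν α τ : ℝ} {M : ℕ} {f : ℝ → L2V Ω} {u0 : H10 Ω} {φ : ℕ → H10 Ω} {r R : ℕ}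
  {ur : ℕ → H10 Ω}

/-- Unconditional stability of the reduced-order model. -/
theorem IsROM.stability (h : IsROM ν α τ M f u0 φ r R ur) (ho : OrthoModes φ r) (hν : 0 ≤ ν)
    (hα : 0 ≤ α) (hτ : 0 < τ) {B F T : ℝ} (hT : M * τ = T) (hF0 : 0 ≤ F)
    (hB : ‖fn u0‖ ≤ B)
    (hF : ∀ k < M, ‖f (((k + 1 : ℕ) : ℝ) * τ)‖ ≤ F) :
    ‖fn (ur M)‖ ≤ B + T * F ∧
    ν * τ * ∑ k ∈ Finset.range M, ‖grad (ur (k + 1))‖ ^ 2 ≤ B ^ 2 + T * F * (B + T * F) := by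
  -- The scheme is tested with its own solution. The mixed inner product is kept because it is used
  -- twice: Cauchy–Schwarz gives linear growth of the norm, and then Young's inequality gives a
  -- telescoping sum of squares.
  have hstep : ∀ k < M, ‖fn (ur (k + 1))‖ ^ 2 - inner ℝ (fn (ur k)) (fn (ur (k + 1)))
      + ν * τ * ‖grad (ur (k + 1))‖ ^ 2 ≤ τ * F * ‖fn (ur (k + 1))‖ := by
    intro k hk
    have h1 := h.step k hk _ (h.mem (k + 1) hk)
    rw [bStar_self, real_inner_self_eq_norm_sq, real_inner_self_eq_norm_sq, real_inner_smul_left,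
      inner_sub_left, real_inner_self_eq_norm_sq] at h1
    have h2 := (real_inner_le_norm (f (((k + 1 : ℕ) : ℝ) * τ)) (fn (ur (k + 1)))).trans
      (mul_le_mul_of_nonneg_right (hF k hk) (norm_nonneg _))
    have h3 : 0 ≤ α * ‖smallScale φ R (grad (ur (k + 1)))‖ ^ 2 := by positivity
    have h4 := mul_le_mul_of_nonneg_left h2 hτ.le
    rw [← h1] at h4
    have e : τ * (τ⁻¹ * (‖fn (ur (k + 1))‖ ^ 2 - inner ℝ (fn (ur k)) (fn (ur (k + 1)))))
        = ‖fn (ur (k + 1))‖ ^ 2 - inner ℝ (fn (ur k)) (fn (ur (k + 1))) := by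
      rw [← mul_assoc, mul_inv_cancel₀ hτ.ne', one_mul]
    have h5 := mul_nonneg hτ.le h3
    nlinarith
  have hbd : ∀ k ≤ M, ‖fn (ur k)‖ ≤ B + k * τ * F := by
    intro k
    induction k with
    | zero =>
      intro _
      rw [h.initial]
      simpa using (ho.norm_podProj_le u0).trans hB
    | succ k ih =>
      intro hk
      have h1 := ih (Nat.le_of_succ_le hk)
      have h2 := hstep k hk
      have h3 := real_inner_le_norm (fn (ur k)) (fn (ur (k + 1)))
      have h4 : 0 ≤ ν * τ * ‖grad (ur (k + 1))‖ ^ 2 := by positivity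
      have h5 : ‖fn (ur (k + 1))‖ ≤ ‖fn (ur k)‖ + τ * F := by
        rcases (norm_nonneg (fn (ur (k + 1)))).eq_or_lt with h0 | h0
        · rw [← h0]; positivity
        · refine le_of_mul_le_mul_right ?_ h0
          nlinarith
      push_cast
      linarith
  have hbd' : ∀ k ≤ M, ‖fn (ur k)‖ ≤ B + T * F := fun k hk => by
    refine (hbd k hk).trans ?_
    have : (k : ℝ) ≤ M := by exact_mod_cast hk
    rw [← hT]
    gcongr
  have hT0 : 0 ≤ T := by rw [← hT]; positivity
  refine ⟨hbd' M le_rfl, ?_⟩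
  have hsum : ∀ k ∈ Finset.range M, (ν * τ * ‖grad (ur (k + 1))‖ ^ 2)
      ≤ (1 / 2) * (‖fn (ur k)‖ ^ 2 - ‖fn (ur (k + 1))‖ ^ 2) + τ * F * (B + T * F) := by
    intro k hk
    have hk' := Finset.mem_range.1 hk
    have h2 := hstep k hk'
    have h3 := real_inner_le_norm (fn (ur k)) (fn (ur (k + 1)))
    have h4 := mul_le_mul_of_nonneg_left (hbd' (k + 1) hk') (mul_nonneg hτ.le hF0)
    nlinarith [sq_nonneg (‖fn (ur k)‖ - ‖fn (ur (k + 1))‖)]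
  have := Finset.sum_le_sum hsum
  rw [← Finset.mul_sum, Finset.sum_add_distrib, ← Finset.mul_sum, Finset.sum_range_sub',
    Finset.sum_const, Finset.card_range, nsmul_eq_mul] at this
  have h0 : ‖fn (ur 0)‖ ^ 2 ≤ B ^ 2 := by
    have := hbd 0 (Nat.zero_le _)
    simp only [Nat.cast_zero, zero_mul, add_zero] at this
    gcongr
  have e : (M : ℝ) * (τ * F * (B + T * F)) = T * F * (B + T * F) := by rw [← hT]; ring
  nlinarith [sq_nonneg ‖fn (ur M)‖]

/-- Young's inequality for the convection term. -/
theorem mul_sqrt_mul_sqrt_le {a g c ε : ℝ} (ha : 0 ≤ a) (hg : 0 ≤ g) (hε : 0 < ε) :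
    c * (√a * √g) * g ≤ ε * g ^ 2 + c ^ 4 / (8 * ε ^ 3) * a ^ 2 := by
  set s := √a with hs
  set t := √g with ht
  have es : s ^ 2 = a := Real.sq_sqrt ha
  have et : t ^ 2 = g := Real.sq_sqrt hg
  rw [← es, ← et]
  -- Two Young inequalities written as squares: c s t³ is bounded through c² s² t² / (2ε), and that
  -- in turn through s⁴ and t⁴.
  have e : ε * (t ^ 2) ^ 2 + c ^ 4 / (8 * ε ^ 3) * (s ^ 2) ^ 2 - c * (s * t) * t ^ 2
      = (ε * t ^ 2 - c * s * t) ^ 2 / (2 * ε)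
        + (2 * ε ^ 2 * t ^ 2 - c ^ 2 * s ^ 2) ^ 2 / (8 * ε ^ 3) := by
    field_simp
    ring
  have : 0 ≤ (ε * t ^ 2 - c * s * t) ^ 2 / (2 * ε)
        + (2 * ε ^ 2 * t ^ 2 - c ^ 2 * s ^ 2) ^ 2 / (8 * ε ^ 3) := by positivity
  linarith

/-- The scalar part of the energy argument: a, g stand for ‖Φ‖, ‖∇Φ‖; x, ρ, π for the projection,
truncation and pressure errors; σ, σ' for the small scales of ∇w, ∇Φ. Convection and the terms
linear in g each take a quarter of ν g²; doubling the remaining half gives the dissipation in the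
conclusion. The term α σ'² is used up entirely. -/
theorem energy_absorb {ν α τ A W a a₀ g x ρ π σ σ' I₀ N : ℝ} (hν : 0 < ν) (hα : 0 ≤ α)
    (hτ : 0 < τ) (ha : 0 ≤ a) (hg : 0 ≤ g) (hI : I₀ ≤ a₀ * a)
    (h : τ⁻¹ * (a ^ 2 - I₀) + ν * g ^ 2 + α * σ' ^ 2
      ≤ ρ * a + ν * (x * g) + 2 * (A * W * x * g) + (A * W) * (√a * √g) * g + N * g * π
        + α * (σ * σ')) :
    a ^ 2 - a₀ ^ 2 + ν * τ * g ^ 2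
      ≤ τ * ((1 + 16 * (A * W) ^ 4 / ν ^ 3) * a ^ 2
        + (ρ ^ 2 + 2 / ν * ((ν + 2 * A * W) * x + N * π) ^ 2 + α / 2 * σ ^ 2)) := by
  have b5 := mul_sqrt_mul_sqrt_le (c := A * W) ha hg (show 0 < ν / 4 by positivity)
  have ec : (A * W) ^ 4 / (8 * (ν / 4) ^ 3) = 8 * (A * W) ^ 4 / ν ^ 3 := by
    field_simp; norm_num
  rw [ec] at b5
  have hκ' : 16 * (A * W) ^ 4 / ν ^ 3 = 2 * (8 * (A * W) ^ 4 / ν ^ 3) := by ring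
  rw [hκ']
  generalize 8 * (A * W) ^ 4 / ν ^ 3 = κ at *
  have hy' : ((ν + 2 * A * W) * x + N * π) * g
      = ν * (x * g) + 2 * (A * W * x * g) + N * g * π := by ring
  generalize (ν + 2 * A * W) * x + N * π = y at *
  have by1 : y * g ≤ ν / 4 * g ^ 2 + 1 / ν * y ^ 2 := by
    have e : ν / 4 * g ^ 2 + 1 / ν * y ^ 2 - y * g = (ν * g - 2 * y) ^ 2 / (4 * ν) := by
      field_simp; ring
    have : 0 ≤ (ν * g - 2 * y) ^ 2 / (4 * ν) := by positivity
    linarith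
  have b7 : α * (σ * σ') ≤ α / 4 * σ ^ 2 + α * σ' ^ 2 := by
    nlinarith [mul_nonneg hα (sq_nonneg (σ - 2 * σ'))]
  have b1 : ρ * a ≤ 1 / 2 * ρ ^ 2 + 1 / 2 * a ^ 2 := by nlinarith [sq_nonneg (ρ - a)]
  have main : τ⁻¹ * (a ^ 2 - I₀) + ν / 2 * g ^ 2
      ≤ 1 / 2 * ρ ^ 2 + 1 / 2 * a ^ 2 + κ * a ^ 2 + 1 / ν * y ^ 2 + α / 4 * σ ^ 2 := by
    linarith
  have main2 := mul_le_mul_of_nonneg_left main (mul_nonneg zero_le_two hτ.le)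
  have e5 : 2 * τ * (τ⁻¹ * (a ^ 2 - I₀) + ν / 2 * g ^ 2) = 2 * (a ^ 2 - I₀) + ν * τ * g ^ 2 := by
    field_simp
  have e6 : 2 * τ * (1 / 2 * ρ ^ 2 + 1 / 2 * a ^ 2 + κ * a ^ 2 + 1 / ν * y ^ 2 + α / 4 * σ ^ 2)
      = τ * ((1 + 2 * κ) * a ^ 2 + (ρ ^ 2 + 2 / ν * y ^ 2 + α / 2 * σ ^ 2)) := by ring
  rw [e5, e6] at main2
  linarith [sq_nonneg (a - a₀), sub_sq a a₀]

/-- The equation for the difference `Φ` of the reduced-order solution and the `L²` projection `w`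
of the exact solution. -/
theorem IsROM.error_equation (h : IsROM ν α τ M f u0 φ r R ur) (ho : OrthoModes φ r)
    {C : ℝ} (hC : SobolevConst Ω C) {k : ℕ} (hk : k < M) {v v' w w₀ Φ Φ₀ η : H10 Ω} {vt : L2V Ω}
    {q q' : L2S Ω}
    (hmom : ∀ y : H10 Ω, inner ℝ vt (fn y) + ν * inner ℝ (grad v') (grad y) + bStar v' v' y
      - divPair y q = inner ℝ (f (((k + 1 : ℕ) : ℝ) * τ)) (fn y))
    (hq : ∀ y ∈ podSpace φ r, divPair y q' = 0) (hw : w = podProj φ r v')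
    (hw₀ : w₀ = podProj φ r v) (e1 : ur (k + 1) = w + Φ) (e2 : ur k = w₀ + Φ₀) (e3 : v' = w + η) :
    τ⁻¹ * (‖fn Φ‖ ^ 2 - inner ℝ (fn Φ₀) (fn Φ)) + ν * ‖grad Φ‖ ^ 2
        + α * ‖smallScale φ R (grad Φ)‖ ^ 2
      = inner ℝ (vt - τ⁻¹ • (fn v' - fn v)) (fn Φ) + ν * inner ℝ (grad η) (grad Φ)
        + (bStar v' η Φ + bStar η w Φ - bStar Φ w Φ) - divPair Φ (q - q')
        - α * inner ℝ (smallScale φ R (grad w)) (smallScale φ R (grad Φ)) := by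
  have hΦm : Φ ∈ podSpace φ r := by
    have e : Φ = ur (k + 1) - w := by rw [e1]; abel
    rw [e, hw]
    exact Submodule.sub_mem _ (h.mem _ hk) (podProj_mem φ r v')
  have hstep := h.step k hk Φ hΦm
  have hm := hmom Φ
  -- Against Φ ∈ X^r the projections in the difference quotient may be replaced by the exact values,
  -- so η leaves no trace there.
  have hp1 := ho.inner_podProj v' hΦm
  have hp0 := ho.inner_podProj v hΦm
  rw [← hw] at hp1
  rw [← hw₀] at hp0
  have hb := hC.bStar_sub_bStar w η Φ
  rw [← e1, ← e3] at hb
  have hgv : grad v' = grad w + grad η := by rw [e3]; rfl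
  rw [hgv, inner_add_left] at hm
  have hgu : grad (ur (k + 1)) = grad w + grad Φ := by rw [e1]; rfl
  have hfu : fn (ur (k + 1)) = fn w + fn Φ := by rw [e1]; rfl
  have hfu₀ : fn (ur k) = fn w₀ + fn Φ₀ := by rw [e2]; rfl
  rw [hgu, smallScale_add, inner_add_left, inner_add_left, real_inner_self_eq_norm_sq,
    real_inner_self_eq_norm_sq, hfu, hfu₀, real_inner_smul_left, inner_sub_left, inner_add_left,
    inner_add_left, real_inner_self_eq_norm_sq, hp1, hp0] at hstep
  rw [inner_sub_left, real_inner_smul_left, inner_sub_left, divPair_sub, hq Φ hΦm]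
  linarith

/-- The energy inequality for the difference of the reduced-order solution and the `L²` projection
of the exact solution, over one time step. -/
theorem IsROM.energy_step (h : IsROM ν α τ M f u0 φ r R ur) (ho : OrthoModes φ r) (hν : 0 < ν)
    (hα : 0 ≤ α) (hτ : 0 < τ) {C A W : ℝ} (hC : SobolevConst Ω C) (hA0 : 0 ≤ A)
    (hA : ∀ v w y : H10 Ω,
      |bStar v w y| ≤ A * ‖grad v‖ * ‖grad w‖ * ‖grad y‖ ∧
      |bStar v w y| ≤ A * (√‖fn v‖ * √‖grad v‖) * ‖grad w‖ * ‖grad y‖)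
    {k : ℕ} (hk : k < M) {v v' w w₀ Φ Φ₀ η : H10 Ω} {vt : L2V Ω} {q q' : L2S Ω}
    (hmom : ∀ y : H10 Ω, inner ℝ vt (fn y) + ν * inner ℝ (grad v') (grad y) + bStar v' v' y
      - divPair y q = inner ℝ (f (((k + 1 : ℕ) : ℝ) * τ)) (fn y))
    (hq : ∀ y ∈ podSpace φ r, divPair y q' = 0) (hwdef : w = podProj φ r v')
    (hw₀def : w₀ = podProj φ r v) (e1 : ur (k + 1) = w + Φ) (e2 : ur k = w₀ + Φ₀)
    (e3 : v' = w + η) (hv : ‖grad v'‖ ≤ W) (hw : ‖grad w‖ ≤ W) :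
    ‖fn Φ‖ ^ 2 - ‖fn Φ₀‖ ^ 2 + ν * τ * ‖grad Φ‖ ^ 2
      ≤ τ * ((1 + 16 * (A * W) ^ 4 / ν ^ 3) * ‖fn Φ‖ ^ 2
        + (‖vt - τ⁻¹ • (fn v' - fn v)‖ ^ 2
          + 2 / ν * ((ν + 2 * A * W) * ‖grad η‖ + n * ‖q - q'‖) ^ 2
          + α / 2 * ‖smallScale φ R (grad w)‖ ^ 2)) := by
  have heq := h.error_equation ho hC hk hmom hq hwdef hw₀def e1 e2 e3
  have b1 := real_inner_le_norm (vt - τ⁻¹ • (fn v' - fn v)) (fn Φ)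
  have b2 := mul_le_mul_of_nonneg_left (real_inner_le_norm (grad η) (grad Φ)) hν.le
  have b3 := (abs_le.1 (hA v' η Φ).1).2
  have b4 := (abs_le.1 (hA η w Φ).1).2
  -- Here Φ convects itself. The full gradient bound would give a multiple of ‖∇Φ‖² that viscosity
  -- need not absorb; the half powers leave only ‖∇Φ‖^{3/2}.
  have b5 := (abs_le.1 (hA Φ w Φ).2).1
  have b6 := (abs_le.1 (abs_divPair_le Φ (q - q'))).1
  have b7 := mul_le_mul_of_nonneg_left (abs_le.1 (abs_real_inner_le_norm
    (smallScale φ R (grad w)) (smallScale φ R (grad Φ)))).1 hα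
  have b3' : A * ‖grad v'‖ * ‖grad η‖ * ‖grad Φ‖ ≤ A * W * ‖grad η‖ * ‖grad Φ‖ := by gcongr
  have b4' : A * ‖grad η‖ * ‖grad w‖ * ‖grad Φ‖ ≤ A * W * ‖grad η‖ * ‖grad Φ‖ := by
    calc A * ‖grad η‖ * ‖grad w‖ * ‖grad Φ‖ ≤ A * ‖grad η‖ * W * ‖grad Φ‖ := by gcongr
      _ = _ := by ring
  have b5' : A * (√‖fn Φ‖ * √‖grad Φ‖) * ‖grad w‖ * ‖grad Φ‖
      ≤ (A * W) * (√‖fn Φ‖ * √‖grad Φ‖) * ‖grad Φ‖ := by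
    calc _ ≤ A * (√‖fn Φ‖ * √‖grad Φ‖) * W * ‖grad Φ‖ := by gcongr
      _ = _ := by ring
  refine energy_absorb (I₀ := inner ℝ (fn Φ₀) (fn Φ)) (σ' := ‖smallScale φ R (grad Φ)‖) hν hα hτ
    (norm_nonneg _) (norm_nonneg _) (real_inner_le_norm _ _) ?_
  rw [heq]
  linarith

end ROM

/-! ### Projection errors and small scales in terms of the error bound. -/

theorem sq_mul_add_sqrt_le {C a b τ s s' L1 L2 L3 : ℝ} (h1 : 0 ≤ L1) (h2 : 0 ≤ L2) (h3 : 0 ≤ L3)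
    (hs : 0 ≤ s) (hs' : 0 ≤ s') :
    (C * (b + τ + √L1)) ^ 2
      ≤ 3 * C ^ 2 * ((1 + s + s') * (τ ^ 2 + b ^ 2) + a ^ 2 + (L1 + L2) + L3) := by
  have es := Real.sq_sqrt h1
  generalize √L1 = x at *
  subst es
  have h4 : (b + τ + x) ^ 2 ≤ 3 * ((1 + s + s') * (τ ^ 2 + b ^ 2) + a ^ 2 + (x ^ 2 + L2) + L3) := by
    nlinarith [sq_nonneg (b - τ), sq_nonneg (b - x), sq_nonneg (τ - x), sq_nonneg a,
      mul_nonneg hs (sq_nonneg τ), mul_nonneg hs' (sq_nonneg τ), mul_nonneg hs (sq_nonneg b),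
      mul_nonneg hs' (sq_nonneg b)]
  calc (C * (b + τ + x)) ^ 2 = C ^ 2 * (b + τ + x) ^ 2 := by ring
    _ ≤ C ^ 2 * (3 * ((1 + s + s') * (τ ^ 2 + b ^ 2) + a ^ 2 + (x ^ 2 + L2) + L3)) := by gcongr
    _ = _ := by ring

/-- To be read with a = h^m, b = h^{m+1}, s = ‖S_r‖₂, s' = ‖S_R‖₂ and L1, L2, L3 the three
eigenvalue sums. The factor 4 counts the summands being squared, as 3 does for the L² error. -/
theorem sq_mul_add_sqrt_mul_le {C a b τ s s' L1 L2 L3 : ℝ} (h1 : 0 ≤ L1) (h2 : 0 ≤ L2)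
    (h3 : 0 ≤ L3) (hs : 0 ≤ s) (hs' : 0 ≤ s') :
    (C * (a + √s * b + √(1 + s) * τ + √L2)) ^ 2
      ≤ 4 * C ^ 2 * ((1 + s + s') * (τ ^ 2 + b ^ 2) + a ^ 2 + (L1 + L2) + L3) := by
  have es := Real.sq_sqrt h2
  have e1 := Real.sq_sqrt hs
  have e2 := Real.sq_sqrt (show 0 ≤ 1 + s by linarith)
  generalize √L2 = x at *
  generalize √(1 + s) = y at *
  generalize √s = z at *
  have h4 : (a + z * b + y * τ + x) ^ 2 ≤ 4 * (a ^ 2 + s * b ^ 2 + (1 + s) * τ ^ 2 + L2) := by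
    rw [← e2, ← e1, ← es]
    linarith [sq_nonneg (a - z * b), sq_nonneg (a - y * τ), sq_nonneg (a - x),
      sq_nonneg (z * b - y * τ), sq_nonneg (z * b - x), sq_nonneg (y * τ - x)]
  have h5 : a ^ 2 + s * b ^ 2 + (1 + s) * τ ^ 2 + L2
      ≤ (1 + s + s') * (τ ^ 2 + b ^ 2) + a ^ 2 + (L1 + L2) + L3 := by
    linarith [mul_nonneg hs' (sq_nonneg τ), mul_nonneg hs' (sq_nonneg b), sq_nonneg b]
  calc (C * (a + z * b + y * τ + x)) ^ 2 = C ^ 2 * (a + z * b + y * τ + x) ^ 2 := by ring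
    _ ≤ C ^ 2 * (4 * ((1 + s + s') * (τ ^ 2 + b ^ 2) + a ^ 2 + (L1 + L2) + L3)) := by
      gcongr
      linarith
    _ = _ := by ring

/-- The squared error bound, up to a constant factor. -/
noncomputable def errorBound (φ : ℕ → H10 Ω) (lam : ℕ → ℝ) (h τ : ℝ) (m d r R : ℕ) : ℝ :=
  (1 + stiffNorm φ r + stiffNorm φ R) * τ ^ 2 + h ^ (2 * m)
    + (1 + stiffNorm φ r + stiffNorm φ R) * h ^ (2 * m + 2)
    + ∑ j ∈ Finset.Ico r d, (1 + h1Sq (φ j)) * lam j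
    + ∑ j ∈ Finset.Ico R d, h1Sq (φ j) * lam j

theorem h1Sq_nonneg (v : H10 Ω) : 0 ≤ h1Sq v := by rw [h1Sq]; positivity

section

variable {φ : ℕ → H10 Ω} {lam : ℕ → ℝ} {h τ : ℝ} {m M d r R : ℕ}

theorem errorBound_components (hlam : ∀ j < d, 0 < lam j) :
    0 ≤ ∑ j ∈ Finset.Ico r d, lam j ∧ 0 ≤ ∑ j ∈ Finset.Ico r d, h1Sq (φ j) * lam j ∧
    0 ≤ ∑ j ∈ Finset.Ico R d, h1Sq (φ j) * lam j ∧
    errorBound φ lam h τ m d r R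
      = (1 + stiffNorm φ r + stiffNorm φ R) * (τ ^ 2 + (h ^ (m + 1)) ^ 2) + (h ^ m) ^ 2
        + (∑ j ∈ Finset.Ico r d, lam j + ∑ j ∈ Finset.Ico r d, h1Sq (φ j) * lam j)
        + ∑ j ∈ Finset.Ico R d, h1Sq (φ j) * lam j := by
  have hl : ∀ s, ∀ j ∈ Finset.Ico s d, 0 ≤ lam j := fun s j hj =>
    (hlam j (Finset.mem_Ico.1 hj).2).le
  refine ⟨Finset.sum_nonneg (hl r),
    Finset.sum_nonneg fun j hj => mul_nonneg (h1Sq_nonneg _) (hl r j hj),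
    Finset.sum_nonneg fun j hj => mul_nonneg (h1Sq_nonneg _) (hl R j hj), ?_⟩
  rw [errorBound, ← Finset.sum_add_distrib]
  simp only [add_mul, one_mul]
  ring

theorem errorBound_bounds (hlam : ∀ j < d, 0 < lam j) :
    0 ≤ errorBound φ lam h τ m d r R ∧ τ ^ 2 ≤ errorBound φ lam h τ m d r R ∧
    (h ^ m) ^ 2 ≤ errorBound φ lam h τ m d r R ∧
    stiffNorm φ r * (τ ^ 2 + (h ^ (m + 1)) ^ 2) ≤ errorBound φ lam h τ m d r R ∧
    ∑ j ∈ Finset.Ico R d, h1Sq (φ j) * lam j ≤ errorBound φ lam h τ m d r R := by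
  obtain ⟨h1, h2, h3, e⟩ := errorBound_components (φ := φ) (h := h) (τ := τ) (m := m) (r := r)
    (R := R) hlam
  rw [e]
  have a1 := stiffNorm_nonneg φ r
  have a2 := stiffNorm_nonneg φ R
  have b1 := mul_nonneg a1 (sq_nonneg τ)
  have b2 := mul_nonneg a2 (sq_nonneg τ)
  have b3 := mul_nonneg a1 (sq_nonneg (h ^ (m + 1)))
  have b4 := mul_nonneg a2 (sq_nonneg (h ^ (m + 1)))
  have b5 := sq_nonneg τ
  have b6 := sq_nonneg (h ^ (m + 1))
  have b7 := sq_nonneg (h ^ m)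
  refine ⟨?_, ?_, ?_, ?_, ?_⟩ <;> linarith

/-- The squared projection errors are controlled by the error bound. -/
theorem PODBounds.sq_le {C₀ : ℝ} {u : ℝ → H10 Ω} (hP : PODBounds C₀ h τ m M u d r lam φ)
    (hlam : ∀ j < d, 0 < lam j) {k : ℕ} (hk : k ≤ M) :
    ‖fn (u (k * τ) - podProj φ r (u (k * τ)))‖ ^ 2
      ≤ 3 * C₀ ^ 2 * errorBound φ lam h τ m d r R ∧
    ‖grad (u (k * τ) - podProj φ r (u (k * τ)))‖ ^ 2
      ≤ 4 * C₀ ^ 2 * errorBound φ lam h τ m d r R := by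
  obtain ⟨h1, h2, h3, e⟩ := errorBound_components (φ := φ) (h := h) (τ := τ) (m := m) (r := r)
    (R := R) hlam
  have l2 := pow_le_pow_left₀ (norm_nonneg _) (hP.l2 k hk) 2
  have hh := pow_le_pow_left₀ (norm_nonneg _) (hP.h1 k hk) 2
  rw [e]
  have a1 := stiffNorm_nonneg φ r
  have a2 := stiffNorm_nonneg φ R
  exact ⟨l2.trans (sq_mul_add_sqrt_le h1 h2 h3 a1 a2),
    hh.trans (sq_mul_add_sqrt_mul_le h1 h2 h3 a1 a2)⟩

theorem sq_norm_smallScale_add_le {P Q D : H10 Ω} (hQ : grad Q ∈ gradSpace φ R) :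
    ‖smallScale φ R (grad (P + (Q + D)))‖ ^ 2 ≤ 2 * ‖grad P‖ ^ 2 + 2 * ‖grad D‖ ^ 2 := by
  rw [grad_add, grad_add, smallScale_add, smallScale_add, smallScale_of_mem hQ, zero_add]
  have h1 := norm_add_le (smallScale φ R (grad P)) (smallScale φ R (grad D))
  have h2 := norm_smallScale_le φ R (grad P)
  have h3 := norm_smallScale_le φ R (grad D)
  have h4 : ‖smallScale φ R (grad P) + smallScale φ R (grad D)‖ ^ 2
      ≤ (‖grad P‖ + ‖grad D‖) ^ 2 := by
    gcongr
    linarith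
  linarith [sq_nonneg (‖grad P‖ - ‖grad D‖), sub_sq ‖grad P‖ ‖grad D‖,
    add_sq ‖grad P‖ ‖grad D‖]

/-- For w a snapshot, P_r v = P_r(v - w) + P_R w + (modes from R to r). The first part costs ‖S_r‖₂
by the inverse inequality, but only on an L² error; the second is annihilated; the third is kept for
averaging over the snapshots. -/
theorem OrthoModes.sq_norm_smallScale_le (ho : OrthoModes φ r) (hR : R ≤ r) (v w : H10 Ω) :
    ‖smallScale φ R (grad (podProj φ r v))‖ ^ 2 ≤ 2 * (stiffNorm φ r * ‖fn (v - w)‖ ^ 2)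
      + 2 * ‖grad (∑ j ∈ Finset.Ico R r, (inner ℝ (fn w) (fn (φ j)) : ℝ) • φ j)‖ ^ 2 := by
  have e : podProj φ r v = podProj φ r (v - w) + (podProj φ R w
      + ∑ j ∈ Finset.Ico R r, (inner ℝ (fn w) (fn (φ j)) : ℝ) • φ j) := by
    rw [← podProj_eq_add φ hR w, podProj_sub φ r v w]
    exact (sub_add_cancel _ _).symm
  have h1 := sq_norm_smallScale_add_le (P := podProj φ r (v - w))
    (D := ∑ j ∈ Finset.Ico R r, (inner ℝ (fn w) (fn (φ j)) : ℝ) • φ j) (grad_podProj_mem φ R w)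
  rw [← e] at h1
  refine h1.trans (add_le_add_left (mul_le_mul_of_nonneg_left ?_ zero_le_two) _)
  exact (ho.sq_norm_grad_le (podProj_mem φ r (v - w))).trans (mul_le_mul_of_nonneg_left
    (pow_le_pow_left₀ (norm_nonneg _) (ho.norm_podProj_le (v - w)) 2) (stiffNorm_nonneg φ r))

/-- The small scales of the projected solution, summed over the time steps. -/
theorem IsPOD.sum_sq_norm_smallScale_le {U : Fin (M + 1) → H10 Ω} {z : ℕ → Fin (M + 1) → ℝ}
    {C₀ T : ℝ} {K : Geometry.SimplicialComplex ℝ (Vec n)} {u : ℝ → H10 Ω} {p : ℝ → L2S Ω}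
    (hp : IsPOD U d lam z φ) (hF : FEBounds C₀ h τ K m M u p U) (hh : 0 ≤ h) (hτ : 0 ≤ τ)
    (hM : 1 ≤ M) (hT : M * τ = T) (hR : R ≤ r) (hr : r ≤ d) :
    τ * ∑ k ∈ Finset.range M,
        ‖smallScale φ R (grad (podProj φ r (u (((k + 1 : ℕ) : ℝ) * τ))))‖ ^ 2
      ≤ (4 * C₀ ^ 2 * T + 4 * T) * errorBound φ lam h τ m d r R := by
  obtain ⟨hE0, -, -, hE1, hE2⟩ := errorBound_bounds (φ := φ) (h := h) (τ := τ) (m := m) (r := r)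
    (R := R) hp.pos
  obtain ⟨E, hE⟩ : ∃ E, E = errorBound φ lam h τ m d r R := ⟨_, rfl⟩
  rw [← hE] at hE0 hE1 hE2 ⊢
  have ho := hp.orthoModes hr
  obtain ⟨D, hD⟩ : ∃ D : Fin (M + 1) → ℝ, ∀ k, D k
      = ‖grad (∑ j ∈ Finset.Ico R r, (inner ℝ (fn (U k)) (fn (φ j)) : ℝ) • φ j)‖ ^ 2 :=
    ⟨_, fun _ => rfl⟩
  have hD0 : ∀ k, 0 ≤ D k := fun k => by rw [hD]; positivity
  have hsumD : ∑ k, D k ≤ (M + 1) * E := by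
    simp_rw [hD]
    rw [hp.sum_sq_norm_grad hr]
    refine mul_le_mul_of_nonneg_left (le_trans ?_ hE2) (by positivity)
    refine (Finset.sum_le_sum fun j hj => ?_).trans (Finset.sum_le_sum_of_subset_of_nonneg
      (Finset.Ico_subset_Ico_right hr) fun j hj _ =>
        mul_nonneg (h1Sq_nonneg _) (hp.pos j (Finset.mem_Ico.1 hj).2).le)
    have := hp.pos j ((Finset.mem_Ico.1 hj).2.trans_le hr)
    rw [h1Sq]
    gcongr
    exact le_add_of_nonneg_left (by positivity)
  have hterm : ∀ k : Fin M,
      ‖smallScale φ R (grad (podProj φ r (u (((k + 1 : ℕ) : ℝ) * τ))))‖ ^ 2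
        ≤ 4 * C₀ ^ 2 * E + 2 * D k.succ := by
    intro k
    have h1 := ho.sq_norm_smallScale_le hR (u (((k + 1 : ℕ) : ℝ) * τ)) (U k.succ)
    rw [← hD] at h1
    have h2 := hF.velocity k.succ
    rw [Fin.val_succ] at h2
    have h3 : ‖fn (u (((k + 1 : ℕ) : ℝ) * τ) - U k.succ)‖ ≤ C₀ * (h ^ (m + 1) + τ) :=
      le_trans (le_add_of_nonneg_right (by positivity)) h2
    have h4 := pow_le_pow_left₀ (norm_nonneg _) h3 2
    have h5 : (C₀ * (h ^ (m + 1) + τ)) ^ 2 ≤ 2 * C₀ ^ 2 * (τ ^ 2 + (h ^ (m + 1)) ^ 2) := by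
      nlinarith [mul_nonneg (sq_nonneg C₀) (sq_nonneg (h ^ (m + 1) - τ))]
    have h6 := mul_le_mul_of_nonneg_left (h4.trans h5) (stiffNorm_nonneg φ r)
    have h7 := mul_le_mul_of_nonneg_left hE1 (sq_nonneg C₀)
    linarith
  have hsum : ∑ k ∈ Finset.range M,
        ‖smallScale φ R (grad (podProj φ r (u (((k + 1 : ℕ) : ℝ) * τ))))‖ ^ 2
      ≤ M * (4 * C₀ ^ 2 * E) + 2 * ((M + 1) * E) := by
    rw [Finset.sum_range fun k =>
      ‖smallScale φ R (grad (podProj φ r (u (((k + 1 : ℕ) : ℝ) * τ))))‖ ^ 2]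
    refine (Finset.sum_le_sum fun k _ => hterm k).trans ?_
    rw [Finset.sum_add_distrib, Finset.sum_const, Finset.card_univ, Fintype.card_fin,
      nsmul_eq_mul, ← Finset.mul_sum]
    -- The POD identity sums over all M + 1 snapshots, the time steps only over nodes 1 to M; the
    -- initial snapshot is dropped by positivity.
    rw [Fin.sum_univ_succ] at hsumD
    have := hD0 0
    linarith
  -- M + 1 ≤ 2M turns the number of snapshots times τ into at most 2T.
  have hM' : (1 : ℝ) ≤ M := by exact_mod_cast hM
  calc _ ≤ τ * (M * (4 * C₀ ^ 2 * E) + 2 * ((M + M) * E)) := by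
        refine mul_le_mul_of_nonneg_left (hsum.trans ?_) hτ
        gcongr
    _ = _ := by rw [← hT]; ring

end

/-! ### Summation in time and the two regimes of the error bound. -/

theorem meshSize_nonneg (K : Geometry.SimplicialComplex ℝ (Vec n)) : 0 ≤ meshSize K := by
  refine Real.sSup_nonneg ?_
  rintro _ ⟨s, _, rfl⟩
  exact Metric.diam_nonneg

/-- The sum of the source terms of the energy inequality. -/
theorem sum_source_le {ν α τ T N C₀ E k₁ k₂ : ℝ} {M : ℕ} {ρ x π σ : ℕ → ℝ} (hν : 0 < ν) (hα : 0 ≤ α)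
    (hτ : 0 ≤ τ) (hT : M * τ = T) (hρ : τ * ∑ k ∈ Finset.range M, ρ k ^ 2 ≤ N * E)
    (hx : ∀ k < M, x k ^ 2 ≤ 4 * C₀ ^ 2 * E) (hπ : ∀ k < M, π k ^ 2 ≤ C₀ ^ 2 * E)
    (hσ : τ * ∑ k ∈ Finset.range M, σ k ^ 2 ≤ (4 * C₀ ^ 2 * T + 4 * T) * E) :
    τ * ∑ k ∈ Finset.range M,
        (ρ k ^ 2 + 2 / ν * (k₁ * x k + k₂ * π k) ^ 2 + α / 2 * σ k ^ 2)
      ≤ (N + T * (2 / ν) * (8 * k₁ ^ 2 * C₀ ^ 2 + 2 * k₂ ^ 2 * C₀ ^ 2)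
        + α / 2 * (4 * C₀ ^ 2 * T + 4 * T)) * E := by
  have hterm : ∀ k ∈ Finset.range M, 2 / ν * (k₁ * x k + k₂ * π k) ^ 2
      ≤ 2 / ν * ((8 * k₁ ^ 2 * C₀ ^ 2 + 2 * k₂ ^ 2 * C₀ ^ 2) * E) := by
    intro k hk
    have hk' := Finset.mem_range.1 hk
    gcongr
    have h1 := mul_le_mul_of_nonneg_left (hx k hk') (sq_nonneg k₁)
    have h2 := mul_le_mul_of_nonneg_left (hπ k hk') (sq_nonneg k₂)
    linarith [sq_nonneg (k₁ * x k - k₂ * π k)]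
  have hsum := Finset.sum_le_sum hterm
  rw [Finset.sum_const, Finset.card_range, nsmul_eq_mul] at hsum
  rw [Finset.sum_add_distrib, Finset.sum_add_distrib, ← Finset.mul_sum (f := fun k => σ k ^ 2)]
  have h1 := mul_le_mul_of_nonneg_left hsum hτ
  have h2 := mul_le_mul_of_nonneg_left hσ (show 0 ≤ α / 2 by positivity)
  have e : τ * (M * (2 / ν * ((8 * k₁ ^ 2 * C₀ ^ 2 + 2 * k₂ ^ 2 * C₀ ^ 2) * E)))
      = T * (2 / ν) * (8 * k₁ ^ 2 * C₀ ^ 2 + 2 * k₂ ^ 2 * C₀ ^ 2) * E := by rw [← hT]; ring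
  linarith

theorem sq_norm_sub_le {E : Type*} [SeminormedAddCommGroup E] (a b : E) :
    ‖a - b‖ ^ 2 ≤ 2 * ‖a‖ ^ 2 + 2 * ‖b‖ ^ 2 := by
  have := pow_le_pow_left₀ (norm_nonneg _) (norm_sub_le a b) 2
  linarith [sq_nonneg (‖a‖ - ‖b‖), sub_sq ‖a‖ ‖b‖, add_sq ‖a‖ ‖b‖]

theorem sq_norm_fn_sub_le (a b c : H10 Ω) :
    ‖fn (a - b)‖ ^ 2 ≤ 2 * ‖fn (a - c)‖ ^ 2 + 2 * ‖fn (b - c)‖ ^ 2 := by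
  have := sq_norm_sub_le (fn a - fn c) (fn b - fn c)
  rwa [sub_sub_sub_cancel_right] at this

theorem sq_norm_grad_sub_le (a b c : H10 Ω) :
    ‖grad (a - b)‖ ^ 2 ≤ 2 * ‖grad (a - c)‖ ^ 2 + 2 * ‖grad (b - c)‖ ^ 2 := by
  have := sq_norm_sub_le (grad a - grad c) (grad b - grad c)
  rwa [sub_sub_sub_cancel_right] at this

section

variable {ν α τ T C₀ h : ℝ} {f : ℝ → L2V Ω} {u : ℝ → H10 Ω} {p : ℝ → L2S Ω} {ut utt : ℝ → L2V Ω}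
  {m M d r R : ℕ} {K : Geometry.SimplicialComplex ℝ (Vec n)} {U : Fin (M + 1) → H10 Ω}
  {lam : ℕ → ℝ} {z : ℕ → Fin (M + 1) → ℝ} {φ : ℕ → H10 Ω} {ur : ℕ → H10 Ω}

/-- The Gronwall rate of the reduced-order error, when the gradients are bounded by `W`. -/
noncomputable def rate (ν A W : ℝ) : ℝ := 1 + 16 * (A * W) ^ 4 / ν ^ 3

/-- The constant in the bound of the source terms. -/
noncomputable def sourceConst (n : ℕ) (ν α T C₀ A W N : ℝ) : ℝ :=
  N + T * (2 / ν) * (8 * (ν + 2 * A * W) ^ 2 * C₀ ^ 2 + 2 * (n : ℝ) ^ 2 * C₀ ^ 2)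
    + α / 2 * (4 * C₀ ^ 2 * T + 4 * T)

/-- The difference of the reduced-order solution and the projected exact solution, provided that
the error bound is at most one. -/
theorem rom_sub_podProj_le (hν : 0 < ν) (hα : 0 ≤ α) (hτ : 0 < τ) (hM : 1 ≤ M) (hT : M * τ = T)
    (hu : IsRegularSolution ν T f u p ut utt) (hh : 0 ≤ h)
    (hF : FEBounds C₀ h τ K m M u p U) (hp : IsPOD U d lam z φ) (hR : R < r) (hr : r ≤ d)
    (hP : PODBounds C₀ h τ m M u d r lam φ) (hrom : IsROM ν α τ M f (u 0) φ r R ur)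
    {C A G : ℝ} (hC : SobolevConst Ω C) (hA0 : 0 ≤ A)
    (hA : ∀ v w y : H10 Ω,
      |bStar v w y| ≤ A * ‖grad v‖ * ‖grad w‖ * ‖grad y‖ ∧
      |bStar v w y| ≤ A * (√‖fn v‖ * √‖grad v‖) * ‖grad w‖ * ‖grad y‖)
    (hG : ∀ t ∈ Ioc 0 T, ‖grad (u t)‖ ≤ G)
    (hrate : rate ν A (G + 2 * |C₀|) * τ ≤ 1 / 2) (hE : errorBound φ lam h τ m d r R ≤ 1) :
    ‖fn (ur M - podProj φ r (u (M * τ)))‖ ^ 2 + ν * τ * ∑ k ∈ Finset.range M,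
        ‖grad (ur (k + 1) - podProj φ r (u (((k + 1 : ℕ) : ℝ) * τ)))‖ ^ 2
      ≤ (1 + rate ν A (G + 2 * |C₀|) * T * Real.exp (2 * rate ν A (G + 2 * |C₀|) * T))
        * (sourceConst n ν α T C₀ A (G + 2 * |C₀|) (∫ s in (0 : ℝ)..T, ‖utt s‖ ^ 2)
          * errorBound φ lam h τ m d r R) := by
  have ho := hp.orthoModes hr
  obtain ⟨hE0, hE1, hE2, -, -⟩ := errorBound_bounds (φ := φ) (h := h) (τ := τ) (m := m) (r := r)
    (R := R) hp.pos
  have hproj : ∀ k ≤ M, _ := fun k hk => hP.sq_le (R := R) hp.pos hk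
  have hσ := hp.sum_sq_norm_smallScale_le hF hh hτ.le hM hT hR.le hr
  have hT0 : 0 < T := by
    rw [← hT]
    have : (1 : ℝ) ≤ M := by exact_mod_cast hM
    positivity
  have hN0 : 0 ≤ ∫ s in (0 : ℝ)..T, ‖utt s‖ ^ 2 :=
    intervalIntegral.integral_nonneg hT0.le fun _ _ => sq_nonneg _
  have hρ := (sum_sq_norm_backward_difference_le hτ hT hu.deriv_u hu.memLp_utt hu.deriv_ut).trans
    ((mul_le_mul_of_nonneg_right hE1 hN0).trans_eq (mul_comm _ _))
  choose! q hqm hq using hF.pressure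
  have hq' : ∀ k < M, ‖p (((k + 1 : ℕ) : ℝ) * τ) - q (k + 1)‖ ^ 2
      ≤ C₀ ^ 2 * errorBound φ lam h τ m d r R := by
    intro k hk
    refine (pow_le_pow_left₀ (norm_nonneg _) (hq (k + 1) (by omega) hk) 2).trans ?_
    rw [mul_pow]
    gcongr
  have hnode : ∀ k < M, ((k + 1 : ℕ) : ℝ) * τ ∈ Ioc 0 T := fun k hk =>
    ⟨by positivity, by rw [← hT]; gcongr; exact hk⟩
  -- The assumption that the error bound is at most one enters only here: it makes ‖∇w‖, and with it
  -- the Gronwall rate, independent of the discretization.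
  have hη : ∀ k < M, ‖grad (u (((k + 1 : ℕ) : ℝ) * τ)
      - podProj φ r (u (((k + 1 : ℕ) : ℝ) * τ)))‖ ≤ 2 * |C₀| := by
    intro k hk
    refine (abs_le_of_sq_le_sq' ?_ (by positivity)).2
    refine (hproj (k + 1) hk).2.trans ?_
    rw [mul_pow, sq_abs]
    nlinarith [mul_le_mul_of_nonneg_left hE (sq_nonneg C₀)]
  have hw : ∀ k < M, ‖grad (podProj φ r (u (((k + 1 : ℕ) : ℝ) * τ)))‖ ≤ G + 2 * |C₀| := by
    intro k hk
    have h1 := norm_sub_le (grad (u (((k + 1 : ℕ) : ℝ) * τ)))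
      (grad (u (((k + 1 : ℕ) : ℝ) * τ) - podProj φ r (u (((k + 1 : ℕ) : ℝ) * τ))))
    rw [grad_sub, sub_sub_cancel, ← grad_sub] at h1
    linarith [hη k hk, hG _ (hnode k hk)]
  have hS := sum_source_le (k₁ := ν + 2 * A * (G + 2 * |C₀|)) (k₂ := n) hν hα hτ.le hT hρ
    (fun k hk => (hproj (k + 1) hk).2) hq' hσ
  refine discrete_gronwall (K := rate ν A (G + 2 * |C₀|))
    (a := fun k => ‖fn (ur k - podProj φ r (u (k * τ)))‖ ^ 2)
    (g := fun k => ‖grad (ur k - podProj φ r (u (k * τ)))‖ ^ 2)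
    hτ.le hν.le (by rw [rate]; positivity) hrate hT ?_ (fun k => by positivity)
    (fun k => by positivity) (fun k => by positivity) ?_ hS
  -- The model starts from P_r u⁰, so Φ vanishes initially.
  · have e0 : ur 0 - podProj φ r (u 0) = 0 := sub_eq_zero.2 hrom.initial
    simp only [Nat.cast_zero, zero_mul]
    rw [e0]
    change ‖(0 : L2V Ω)‖ ^ 2 = 0
    simp
  · intro k hk
    exact hrom.energy_step ho hν hα hτ hC hA0 hA hk (hu.momentum _ (hnode k hk))
      (fun y hy => hp.divPair_eq_zero hr (fun l => (hF.mem l).2 _ (hqm (k + 1) (by omega) hk)) hy)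
      rfl rfl (add_sub_cancel _ _).symm (add_sub_cancel _ _).symm (add_sub_cancel _ _).symm
      ((hG _ (hnode k hk)).trans (by linarith [abs_nonneg C₀])) (hw k hk)

/-- The error estimate, provided that the error bound is at most one. -/
theorem error_le_of_errorBound_le_one (hν : 0 < ν) (hτ : 0 ≤ τ) (hT : M * τ = T)
    (hlam : ∀ j < d, 0 < lam j) (hP : PODBounds C₀ h τ m M u d r lam φ) {S : ℝ}
    (hS : ‖fn (ur M - podProj φ r (u (M * τ)))‖ ^ 2 + ν * τ * ∑ k ∈ Finset.range M,
        ‖grad (ur (k + 1) - podProj φ r (u (((k + 1 : ℕ) : ℝ) * τ)))‖ ^ 2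
      ≤ S * errorBound φ lam h τ m d r R) :
    ‖fn (u T - ur M)‖ ^ 2 + ν * τ * ∑ k ∈ Finset.range M,
        ‖grad (u (((k + 1 : ℕ) : ℝ) * τ) - ur (k + 1))‖ ^ 2
      ≤ (6 * C₀ ^ 2 + 8 * ν * T * C₀ ^ 2 + 2 * S) * errorBound φ lam h τ m d r R := by
  have hproj : ∀ k ≤ M, _ := fun k hk => hP.sq_le (R := R) hlam hk
  have h1 : ‖fn (u T - ur M)‖ ^ 2 ≤ 2 * (3 * C₀ ^ 2 * errorBound φ lam h τ m d r R)
      + 2 * ‖fn (ur M - podProj φ r (u (M * τ)))‖ ^ 2 := by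
    rw [← hT]
    exact (sq_norm_fn_sub_le _ _ _).trans (add_le_add_left
      (mul_le_mul_of_nonneg_left (hproj M le_rfl).1 zero_le_two) _)
  have h2 : ∀ k ∈ Finset.range M, ‖grad (u (((k + 1 : ℕ) : ℝ) * τ) - ur (k + 1))‖ ^ 2
      ≤ 2 * (4 * C₀ ^ 2 * errorBound φ lam h τ m d r R)
        + 2 * ‖grad (ur (k + 1) - podProj φ r (u (((k + 1 : ℕ) : ℝ) * τ)))‖ ^ 2 := by
    intro k hk
    exact (sq_norm_grad_sub_le _ _ _).trans (add_le_add_left (mul_le_mul_of_nonneg_left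
      (hproj (k + 1) (Finset.mem_range.1 hk)).2 zero_le_two) _)
  have h3 := Finset.sum_le_sum h2
  rw [Finset.sum_add_distrib, Finset.sum_const, Finset.card_range, nsmul_eq_mul,
    ← Finset.mul_sum] at h3
  have h4 := mul_le_mul_of_nonneg_left h3 (mul_nonneg hν.le hτ)
  have e : ν * τ * (M * (2 * (4 * C₀ ^ 2 * errorBound φ lam h τ m d r R)))
      = 8 * ν * T * C₀ ^ 2 * errorBound φ lam h τ m d r R := by rw [← hT]; ring
  linarith

/-- The error is bounded by the stability of the exact and the reduced-order solution. -/
theorem error_le_of_bounds (hν : 0 < ν) (hα : 0 ≤ α) (hτ : 0 < τ) (hT : M * τ = T)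
    (ho : OrthoModes φ r) (hrom : IsROM ν α τ M f (u 0) φ r R ur) {B F G : ℝ} (hF0 : 0 ≤ F)
    (hF : ∀ t ∈ Icc 0 T, ‖f t‖ ≤ F) (hB : ∀ t ∈ Icc 0 T, ‖fn (u t)‖ ≤ B)
    (hG : ∀ t ∈ Ioc 0 T, ‖grad (u t)‖ ≤ G) :
    ‖fn (u T - ur M)‖ ^ 2 + ν * τ * ∑ k ∈ Finset.range M,
        ‖grad (u (((k + 1 : ℕ) : ℝ) * τ) - ur (k + 1))‖ ^ 2
      ≤ 2 * B ^ 2 + 2 * (B + T * F) ^ 2 + 2 * ν * T * G ^ 2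
        + 2 * (B ^ 2 + T * F * (B + T * F)) := by
  have hT0 : 0 ≤ T := by rw [← hT]; positivity
  have hnode : ∀ k < M, ((k + 1 : ℕ) : ℝ) * τ ∈ Ioc 0 T := fun k hk =>
    ⟨by positivity, by rw [← hT]; gcongr; exact hk⟩
  obtain ⟨hs1, hs2⟩ := hrom.stability ho hν.le hα hτ hT hF0 (hB 0 (left_mem_Icc.2 hT0))
    fun k hk => hF _ (Ioc_subset_Icc_self (hnode k hk))
  have h1 := sq_norm_sub_le (fn (u T)) (fn (ur M))
  rw [← fn_sub] at h1
  have h2 := pow_le_pow_left₀ (norm_nonneg _) (hB T (right_mem_Icc.2 hT0)) 2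
  have h3 := pow_le_pow_left₀ (norm_nonneg _) hs1 2
  have h4 : ∀ k ∈ Finset.range M, ‖grad (u (((k + 1 : ℕ) : ℝ) * τ) - ur (k + 1))‖ ^ 2
      ≤ 2 * G ^ 2 + 2 * ‖grad (ur (k + 1))‖ ^ 2 := by
    intro k hk
    rw [grad_sub]
    exact (sq_norm_sub_le _ _).trans (add_le_add_left (mul_le_mul_of_nonneg_left
      (pow_le_pow_left₀ (norm_nonneg _) (hG _ (hnode k (Finset.mem_range.1 hk))) 2)
      zero_le_two) _)
  have h5 := Finset.sum_le_sum h4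
  rw [Finset.sum_add_distrib, Finset.sum_const, Finset.card_range, nsmul_eq_mul,
    ← Finset.mul_sum] at h5
  have h6 := mul_le_mul_of_nonneg_left h5 (mul_nonneg hν.le hτ.le)
  have e : ν * τ * (M * (2 * G ^ 2)) = 2 * ν * T * G ^ 2 := by rw [← hT]; ring
  linarith

/-- The constant of the error estimate when the error bound is at most one. -/
noncomputable def smallErrorConst (n : ℕ) (ν α T C₀ A W N : ℝ) : ℝ :=
  6 * C₀ ^ 2 + 8 * ν * T * C₀ ^ 2
    + 2 * ((1 + rate ν A W * T * Real.exp (2 * rate ν A W * T)) * sourceConst n ν α T C₀ A W N)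

/-- The constant in the stability bound of the error. -/
noncomputable def stabilityConst (ν T B F G : ℝ) : ℝ :=
  2 * B ^ 2 + 2 * (B + T * F) ^ 2 + 2 * ν * T * G ^ 2 + 2 * (B ^ 2 + T * F * (B + T * F))

theorem rate_pos {A W : ℝ} (hν : 0 < ν) : 0 < rate ν A W := by
  rw [rate]
  positivity

theorem smallErrorConst_nonneg {A W N : ℝ} (hν : 0 < ν) (hα : 0 ≤ α) (hT : 0 ≤ T) (hN : 0 ≤ N) :
    0 ≤ smallErrorConst n ν α T C₀ A W N := by
  have h1 : 0 < rate ν A W := rate_pos hν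
  have h2 : 0 ≤ sourceConst n ν α T C₀ A W N := by
    rw [sourceConst]
    positivity
  rw [smallErrorConst]
  positivity

theorem stabilityConst_nonneg {B F G : ℝ} (hν : 0 < ν) (hT : 0 ≤ T) (hB : 0 ≤ B) (hF : 0 ≤ F) :
    0 ≤ stabilityConst ν T B F G := by
  rw [stabilityConst]
  positivity

/-- The error estimate, with an explicit constant. -/
theorem sq_norm_error_le (hν : 0 < ν) (hα : 0 ≤ α) (hτ : 0 < τ) (hM : 1 ≤ M) (hT : M * τ = T)
    (hu : IsRegularSolution ν T f u p ut utt) (hh : 0 ≤ h)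
    (hFE : FEBounds C₀ h τ K m M u p U) (hp : IsPOD U d lam z φ) (hR : R < r) (hr : r ≤ d)
    (hP : PODBounds C₀ h τ m M u d r lam φ) (hrom : IsROM ν α τ M f (u 0) φ r R ur)
    {C A B F G : ℝ} (hC : SobolevConst Ω C) (hA0 : 0 ≤ A)
    (hA : ∀ v w y : H10 Ω,
      |bStar v w y| ≤ A * ‖grad v‖ * ‖grad w‖ * ‖grad y‖ ∧
      |bStar v w y| ≤ A * (√‖fn v‖ * √‖grad v‖) * ‖grad w‖ * ‖grad y‖)
    (hF0 : 0 ≤ F) (hF : ∀ t ∈ Icc 0 T, ‖f t‖ ≤ F) (hB0 : 0 ≤ B)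
    (hB : ∀ t ∈ Icc 0 T, ‖fn (u t)‖ ≤ B) (hG : ∀ t ∈ Ioc 0 T, ‖grad (u t)‖ ≤ G)
    (hrate : rate ν A (G + 2 * |C₀|) * τ ≤ 1 / 2) :
    ‖fn (u T - ur M)‖ ^ 2 + ν * τ * ∑ k ∈ Finset.range M,
        ‖grad (u (((k + 1 : ℕ) : ℝ) * τ) - ur (k + 1))‖ ^ 2
      ≤ (smallErrorConst n ν α T C₀ A (G + 2 * |C₀|) (∫ s in (0 : ℝ)..T, ‖utt s‖ ^ 2)
          + stabilityConst ν T B F G) * errorBound φ lam h τ m d r R := by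
  have hT0 : 0 ≤ T := by rw [← hT]; positivity
  have hN0 : 0 ≤ ∫ s in (0 : ℝ)..T, ‖utt s‖ ^ 2 :=
    intervalIntegral.integral_nonneg hT0 fun _ _ => sq_nonneg _
  have h1 := smallErrorConst_nonneg (n := n) (C₀ := C₀) (A := A) (W := G + 2 * |C₀|) hν hα hT0 hN0
  have h2 := stabilityConst_nonneg (G := G) hν hT0 hB0 hF0
  have hE0 := (errorBound_bounds (φ := φ) (h := h) (τ := τ) (m := m) (r := r) (R := R) hp.pos).1
  -- For a small error bound the energy argument applies. Otherwise the stability constant is at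
  -- most itself times the error bound. Adding both constants covers the two cases.
  rcases le_total (errorBound φ lam h τ m d r R) 1 with hE | hE
  · have hS := rom_sub_podProj_le hν hα hτ hM hT hu hh hFE hp hR hr hP hrom hC hA0 hA hG hrate hE
    rw [← mul_assoc] at hS
    exact (error_le_of_errorBound_le_one hν hτ.le hT hp.pos hP hS).trans
      (mul_le_mul_of_nonneg_right (le_add_of_nonneg_right h2) hE0)
  · exact (error_le_of_bounds hν hα hτ hT (hp.orthoModes hr) hrom hF0 hF hB hG).trans
      ((le_add_of_nonneg_left h1).trans (le_mul_of_one_le_right (add_nonneg h1 h2) hE))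

end

end VMSPOD

set_option maxHeartbeats 800000 in
theorem theorem3p1 (n : ℕ) (hn : n = 2 ∨ n = 3) (Ω : Set (VMSPOD.Vec n)) (hΩ : IsOpen Ω)
    (hb : Bornology.IsBounded Ω) (ν α T C₀ : ℝ) (hν : 0 < ν) (hα : 0 < α) (hT : 0 < T)
    (f : ℝ → VMSPOD.L2V Ω) (u : ℝ → VMSPOD.H10 Ω) (p : ℝ → VMSPOD.L2S Ω)
    (ut utt : ℝ → VMSPOD.L2V Ω) (hu : VMSPOD.IsRegularSolution ν T f u p ut utt) :
    ∃ C ΔtStar : ℝ, 0 < ΔtStar ∧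
      ∀ (m : ℕ), 2 ≤ m →
      ∀ (K : Geometry.SimplicialComplex ℝ (VMSPOD.Vec n)), VMSPOD.IsMesh Ω K →
      ∀ (h : ℝ), h = VMSPOD.meshSize K →
      ∀ (M : ℕ), 1 ≤ M → ∀ (Δt : ℝ), Δt = T / M → Δt < ΔtStar →
      ∀ (U : Fin (M + 1) → VMSPOD.H10 Ω), VMSPOD.FEBounds C₀ h Δt K m M u p U →
      ∀ (d : ℕ) (lam : ℕ → ℝ) (z : ℕ → Fin (M + 1) → ℝ) (φ : ℕ → VMSPOD.H10 Ω),
        VMSPOD.IsPOD U d lam z φ →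
      ∀ (r R : ℕ), R < r → r ≤ d → VMSPOD.PODBounds C₀ h Δt m M u d r lam φ →
      ∀ (ur : ℕ → VMSPOD.H10 Ω), VMSPOD.IsROM ν α Δt M f (u 0) φ r R ur →
        ‖VMSPOD.fn (u T - ur M)‖ ^ 2
            + ν * Δt * ∑ k ∈ Finset.range M,
                ‖VMSPOD.grad (u (((k + 1 : ℕ) : ℝ) * Δt) - ur (k + 1))‖ ^ 2
          ≤ C * ((1 + VMSPOD.stiffNorm φ r + VMSPOD.stiffNorm φ R) * Δt ^ 2
              + h ^ (2 * m)
              + (1 + VMSPOD.stiffNorm φ r + VMSPOD.stiffNorm φ R) * h ^ (2 * m + 2)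
              + ∑ j ∈ Finset.Ico r d, (1 + VMSPOD.h1Sq (φ j)) * lam j
              + ∑ j ∈ Finset.Ico R d, VMSPOD.h1Sq (φ j) * lam j) := by
  obtain ⟨Cs, hCs⟩ := VMSPOD.exists_sobolevConst (Ω := Ω) hn hb
  obtain ⟨A, hA0, hA⟩ := VMSPOD.exists_bStar_bound (Ω := Ω) hn hb
  obtain ⟨F, hF0, hF⟩ := hu.exists_bound_f
  obtain ⟨B, hB0, hB⟩ := hu.exists_bound_u
  obtain ⟨G, -, hG⟩ := hu.exists_bound_grad hν hT.le
  have hκ : 0 < VMSPOD.rate ν A (G + 2 * |C₀|) := VMSPOD.rate_pos hν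
  -- The threshold 1 / (2 · rate) is the time step condition of the Gronwall inequality; like the
  -- constant, it is fixed before any discretization is chosen.
  refine ⟨VMSPOD.smallErrorConst n ν α T C₀ A (G + 2 * |C₀|) (∫ s in (0 : ℝ)..T, ‖utt s‖ ^ 2)
    + VMSPOD.stabilityConst ν T B F G, 1 / (2 * VMSPOD.rate ν A (G + 2 * |C₀|)), by positivity, ?_⟩
  intro m _ K _ h hh M hM Δt hΔt hΔts U hFE d lam z φ hpod r R hR hr hPOD ur hrom
  have hM' : (0 : ℝ) < M := by exact_mod_cast hM
  have hτ : 0 < Δt := by rw [hΔt]; positivity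
  have hMT : M * Δt = T := by rw [hΔt]; field_simp
  rw [lt_div_iff₀ (by positivity)] at hΔts
  exact VMSPOD.sq_norm_error_le hν hα.le hτ hM hMT hu (hh ▸ VMSPOD.meshSize_nonneg K) hFE hpod hR
    hr hPOD hrom hCs hA0 hA hF0 hF hB0 hB hG (by linarith)
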